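/- Let $T=\{0,\tfrac12,\tfrac13,\dots,\tfrac1n,\dots\}$. Let $(\lambda_j)_{j\ge 2}$, $(f_j)_{j\ge 2}$, $(g_j)_{j\ge 2}$ be real sequences with $\lambda_j>0$, $0<f_j<1$, $0<g_j<1$ for all $j\ge 2$, with $\lim_{j\to\infty}\lambda_j=0$, and with $$\sum_{j=2}^\infty \frac{1-f_j}{\lambda_j}<1,\qquad \sum_{j=2}^\infty \frac{1-g_j}{\lambda_j}<1 .$$ Define a kernel $U$ on $T\times T$ by $U(0,0)=2$, $U(0,1/j)=1+g_j$, $U(1/i,0)=1+f_i$ and $U(1/i,1/j)=\lambda_i\delta_{i,j}+1+f_ig_j$ for $i,j\ge 2$. For $\alpha>0$, an $\alpha$-permanental sequence with kernel $U$ is a stochastic process $\{X_t;\,t\in T\}$ with values in $[0,\infty)$ such that for all $t_1,\dots,t_n\in T$ and all $s_1,\dots,s_n\ge 0$, $$E\Big(e^{-\sum_{i=1}^n s_iX_{t_i}}\Big)=\frac{1}{\det(I+KS)^{\alpha}},\qquad K=\big(U(t_i,t_j)\big)_{i,j=1}^n,\quad S=\mathrm{diag}(s_1,\dots,s_n).$$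 Suppose that $\lim_{n\to\infty}\lambda_n\log n=\beta$ with $0<\beta<\infty$. Then for every integer $k\ge 1$ and every $k/2$-permanental sequence $X$ with kernel $U$, $$\limsup_{n\to\infty}|X_{1/n}-X_0|=\beta+2\beta^{1/2}X_0^{1/2}\quad\text{a.s.},$$ $$\limsup_{n\to\infty}\,(X_{1/n}-X_0)=\beta+2\beta^{1/2}X_0^{1/2}\quad\text{a.s.},$$ $$\liminf_{n\to\infty}\,(X_{1/n}-X_0)=\begin{cases}-X_0, & \text{if } X_0<\beta,\\ \beta-2\beta^{1/2}X_0^{1/2}, & \text{if } X_0\ge\beta,\end{cases}\quad\text{a.s.}$$ In particular, $X$ has almost surely a bounded random discontinuity at $0$. -/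

import Mathlib

open MeasureTheory Filter Topology

namespace PermSeq

/-- The index set `T = {0, 1/2, 1/3, …, 1/n, …}`. -/
def T : Set ℝ := {t | t = 0 ∨ ∃ n : ℕ, 2 ≤ n ∧ t = 1 / (n : ℝ)}

/-- The point `0` of `T`. -/
def zeroPt : T := ⟨0, Or.inl rfl⟩

/-- The point `1/n` of `T`, for `n ≥ 2` (with the irrelevant value `0` for `n = 0, 1`, where `1/n`
is not an element of `T`). -/
noncomputable def invPt (n : ℕ) : T :=
  if h : 2 ≤ n then ⟨1 / (n : ℝ), Or.inr ⟨n, h, rfl⟩⟩ else zeroPt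

/-- The index in `{0, 2, 3, …}` of a point of `T`: the point `1/n` has index `n`, and the point `0`
has index `0` (see `idx_zeroPt` and `idx_invPt`). -/
noncomputable def idx (t : T) : ℕ := ⌊1 / (t : ℝ)⌋₊

/-- The matrix `G i j = lam i * δ i j + 1 + f i * g j`; only indices in `{0, 2, 3, …}` are used. -/
def G (lam f g : ℕ → ℝ) (i j : ℕ) : ℝ :=
  (if i = j then lam i else 0) + 1 + f i * g j

/-- The kernel on `T`: `U(1/i, 1/j) = G i j`, where `0` plays the role of `1/i` with index `0`. -/
noncomputable def U (lam f g : ℕ → ℝ) (s t : T) : ℝ := G lam f g (idx s) (idx t)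

/-- The standing assumptions on the sequences which define the kernel. The values at the
index `1` are not used anywhere. -/
structure Admissible (lam f g : ℕ → ℝ) : Prop where
  lam_zero : lam 0 = 0
  f_zero : f 0 = 1
  g_zero : g 0 = 1
  lam_pos : ∀ j, 2 ≤ j → 0 < lam j
  f_mem : ∀ j, 2 ≤ j → 0 < f j ∧ f j < 1
  g_mem : ∀ j, 2 ≤ j → 0 < g j ∧ g j < 1
  lam_tendsto : Tendsto lam atTop (𝓝 0)
  /-- `∑_{j ≥ 2} (1 - f j) / lam j` converges, with sum less than `1`. -/
  f_summable : Summable fun j : ℕ => (1 - f (j + 2)) / lam (j + 2)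
  f_sum_lt : ∑' j : ℕ, (1 - f (j + 2)) / lam (j + 2) < 1
  /-- `∑_{j ≥ 2} (1 - g j) / lam j` converges, with sum less than `1`. -/
  g_summable : Summable fun j : ℕ => (1 - g (j + 2)) / lam (j + 2)
  g_sum_lt : ∑' j : ℕ, (1 - g (j + 2)) / lam (j + 2) < 1

/-- `X` is an `α`-permanental process with index set `S` and kernel `K`: a nonnegative process whose
finite dimensional distributions have the Laplace transforms
`E exp (-∑ sᵢ X_{tᵢ}) = 1 / |I + K(t) S|^α`, where `K(t) = {K(tᵢ, tⱼ)}` and `S` is the diagonal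
matrix with entries `sᵢ ≥ 0`. -/
structure IsPermanental {Ω S : Type*} [MeasurableSpace Ω] (P : Measure Ω)
    (α : ℝ) (K : S → S → ℝ) (X : S → Ω → ℝ) : Prop where
  aemeasurable : ∀ t, AEMeasurable (X t) P
  nonneg : ∀ t, ∀ᵐ ω ∂P, 0 ≤ X t ω
  laplace : ∀ (n : ℕ) (t : Fin n → S) (s : Fin n → ℝ), (∀ i, 0 ≤ s i) →
    ∫ ω, Real.exp (-∑ i, s i * X (t i) ω) ∂P =
      1 / ((1 + Matrix.of (fun i j => K (t i) (t j)) * Matrix.diagonal s).det) ^ α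

theorem idx_zeroPt : idx zeroPt = 0 := by
  simp [idx, zeroPt]

theorem idx_invPt (n : ℕ) (hn : 2 ≤ n) : idx (invPt n) = n := by
  simp [idx, invPt, hn]

theorem U_zero_zero {lam f g : ℕ → ℝ} (h : Admissible lam f g) :
    U lam f g zeroPt zeroPt = 2 := by
  simp only [U, idx_zeroPt, G, h.lam_zero, h.f_zero, h.g_zero]; norm_num

theorem U_zero_inv {lam f g : ℕ → ℝ} (h : Admissible lam f g) (j : ℕ) (hj : 2 ≤ j) :
    U lam f g zeroPt (invPt j) = 1 + g j := by
  have h0 : ¬ (0 = j) := by omega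
  simp [U, idx_zeroPt, idx_invPt j hj, G, h.f_zero, h0]

theorem U_inv_zero {lam f g : ℕ → ℝ} (h : Admissible lam f g) (i : ℕ) (hi : 2 ≤ i) :
    U lam f g (invPt i) zeroPt = 1 + f i := by
  have h0 : ¬ (i = 0) := by omega
  simp [U, idx_zeroPt, idx_invPt i hi, G, h.g_zero, h0]

theorem U_inv_inv (lam f g : ℕ → ℝ) (i j : ℕ) (hi : 2 ≤ i) (hj : 2 ≤ j) :
    U lam f g (invPt i) (invPt j) = (if i = j then lam i else 0) + 1 + f i * g j := by
  simp [U, idx_invPt i hi, idx_invPt j hj, G]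

end PermSeq

/-! The kernel need not be symmetric, so `X` has no Gaussian representation to start from; instead
its law is bounded below by a multiple of a Gaussian one.

Along `0, 1/N, 1/(N+1), …` the kernel is a diagonal matrix plus one of rank two, so the Laplace
transform is explicit. With `a = 1 - f` and `b = 1 - g`, the determinant factors
(`DefectData.det_factor`) into `∏ (1 + λ_i s_i)`, a factor `M (1 - r(s)/M)`, and `s_0 + κ + ∑ ρ_i
d_i - q(s)`, where `r` and `q` are Laplace transforms of positive measures, `r < M` and `q < κ`. If
`r` and `q` were dropped, what remained would be, up to a constant, the transform of `Y_0 =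
|z|²/(2κ)`, `Y_i = |√(ρ_i/κ) z + √λ_i ξ_i|²/2`, with `z, ξ_i` independent standard Gaussian vectors
in dimension `k`. Expanding in powers of `r` and `q` produces only nonnegative terms, so `c_N ·
law(Y) ≤ law(X)` with `c_N = (Mκ)^(-k/2)` (`DefectData.smul_le`).

For `Y`, Borel–Cantelli and `λ_n log n → β` show that the cluster set of `√λ_i ξ_i` is the closed
ball `|w|²/2 ≤ β` (`ae_cluster`). Since `ρ_i → 1`, the extremes of `|z/√κ + w|²/2` over this ball
give the three limits (`hasOscillation_halfSq`).

Hence the claimed event has probability at least `c_N` for `X`. It does not depend on `N`, and `c_N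
→ 1` because `M → 2` and `κ → 1/2`. -/

namespace PermSeq

open scoped NNReal ENNReal BoundedContinuousFunction
open ProbabilityTheory

/-! ### Laplace transforms of measures on sequences, and uniqueness. -/

/-- The pairing of a finitely supported sequence with a sequence. -/
noncomputable def pairing (s : ℕ →₀ ℝ≥0) (y : ℕ → ℝ≥0) : ℝ := s.sum fun i c => (c : ℝ) * y i

@[simp] theorem pairing_zero (y : ℕ → ℝ≥0) : pairing 0 y = 0 := by simp [pairing]

theorem pairing_add (s t : ℕ →₀ ℝ≥0) (y : ℕ → ℝ≥0) :
    pairing (s + t) y = pairing s y + pairing t y :=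
  Finsupp.sum_add_index' (by simp) (by intros; push_cast; ring)

theorem pairing_add_right (s : ℕ →₀ ℝ≥0) (y z : ℕ → ℝ≥0) :
    pairing s (y + z) = pairing s y + pairing s z := by
  simp only [pairing, Finsupp.sum, Pi.add_apply, NNReal.coe_add, mul_add, Finset.sum_add_distrib]

theorem pairing_nonneg (s : ℕ →₀ ℝ≥0) (y : ℕ → ℝ≥0) : 0 ≤ pairing s y :=
  Finset.sum_nonneg fun i _ => by positivity

theorem continuous_pairing (s : ℕ →₀ ℝ≥0) : Continuous (pairing s) := by
  unfold pairing Finsupp.sum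
  fun_prop

@[fun_prop]
theorem measurable_pairing (s : ℕ →₀ ℝ≥0) : Measurable (pairing s) :=
  (continuous_pairing s).measurable

theorem pairing_single (i : ℕ) (c : ℝ≥0) (y : ℕ → ℝ≥0) :
    pairing (Finsupp.single i c) y = c * y i := by
  simp [pairing]

theorem pairing_Pi_single (s : ℕ →₀ ℝ≥0) (i : ℕ) (c : ℝ≥0) :
    pairing s (Pi.single i c) = s i * c := by
  rw [pairing, Finsupp.sum_of_support_subset s (s := insert i s.support) (by simp) _ (by simp),
    Finset.sum_eq_single i]
  · simp
  · intro j _ hj; simp [Pi.single_eq_of_ne hj]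
  · simp

theorem pairing_eq_sum (s : ℕ →₀ ℝ≥0) (y : ℕ → ℝ≥0) {n : ℕ} (hn : ∀ i, n ≤ i → s i = 0) :
    pairing s y = ∑ i ∈ Finset.range n, (s i : ℝ) * y i := by
  refine Finsupp.sum_of_support_subset s (fun i hi => ?_) _ (by simp)
  by_contra h
  exact (Finsupp.mem_support_iff.1 hi) (hn i (by simpa using h))

/-- The exponential `y ↦ exp (-⟨s, y⟩)`, as a monoid homomorphism in `s`. -/
noncomputable def expHom : Multiplicative (ℕ →₀ ℝ≥0) →* ((ℕ → ℝ≥0) →ᵇ ℝ) where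
  toFun s := BoundedContinuousFunction.ofNormedAddCommGroup
    (fun y => Real.exp (-pairing s.toAdd y))
    (Real.continuous_exp.comp (continuous_pairing _).neg) 1 (fun y => by
      rw [Real.norm_eq_abs, Real.abs_exp, Real.exp_le_one_iff, neg_nonpos]
      exact pairing_nonneg _ _)
  map_one' := by ext; simp
  map_mul' s t := by ext y; simp [pairing_add, ← Real.exp_add, add_comm]

@[simp] theorem expHom_apply (s : Multiplicative (ℕ →₀ ℝ≥0)) (y : ℕ → ℝ≥0) :
    expHom s y = Real.exp (-pairing s.toAdd y) := rfl

/-- Finite measures on sequences of nonnegative reals are determined by their Laplace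
transforms. -/
theorem measure_ext_of_laplace {μ ν : Measure (ℕ → ℝ≥0)} [IsFiniteMeasure μ] [IsFiniteMeasure ν]
    (h : ∀ s, ∫ y, Real.exp (-pairing s y) ∂μ = ∫ y, Real.exp (-pairing s y) ∂ν) : μ = ν := by
  let A : StarSubalgebra ℝ ((ℕ → ℝ≥0) →ᵇ ℝ) :=
    { Algebra.adjoin ℝ (MonoidHom.mrange expHom : Set ((ℕ → ℝ≥0) →ᵇ ℝ)) with
      star_mem' := fun {a} ha => by
        have : star a = a := by ext; simp
        rwa [this] }
  -- The exponentials are closed under multiplication, so the algebra they generate is their linear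
  -- span, and integrals need comparing only on exponentials.
  have hmem : ∀ g, g ∈ A ↔
      g ∈ Submodule.span ℝ (MonoidHom.mrange expHom : Set ((ℕ → ℝ≥0) →ᵇ ℝ)) := by
    intro g
    change g ∈ Subalgebra.toSubmodule (Algebra.adjoin ℝ _) ↔ _
    rw [Algebra.adjoin_eq_span, Submonoid.closure_eq]
  refine ext_of_forall_mem_subalgebra_integral_eq_of_polish (𝕜 := ℝ) (A := A) ?_ ?_
  · intro x y hxy
    obtain ⟨i, hi⟩ := Function.ne_iff.1 hxy
    refine ⟨_, ⟨_, ⟨expHom (Multiplicative.ofAdd (Finsupp.single i 1)), ?_, rfl⟩, rfl⟩, ?_⟩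
    · exact (hmem _).2 (Submodule.subset_span ⟨_, rfl⟩)
    · simpa [pairing_single] using hi
  · intro g hg
    rw [hmem] at hg
    induction hg using Submodule.span_induction with
    | mem x hx => obtain ⟨s, rfl⟩ := hx; exact h _
    | zero => simp
    | add x y _ _ hx hy =>
      have hi := fun (f : (ℕ → ℝ≥0) →ᵇ ℝ) => f.integrable μ
      have hj := fun (f : (ℕ → ℝ≥0) →ᵇ ℝ) => f.integrable ν
      simp only [BoundedContinuousFunction.coe_add, Pi.add_apply]
      rw [integral_add (hi x) (hi y), integral_add (hj x) (hj y), hx, hy]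
    | smul a x _ hx =>
      simp only [BoundedContinuousFunction.coe_smul, smul_eq_mul, integral_const_mul, hx]

/-- The Laplace transform of a measure on sequences of nonnegative reals. -/
noncomputable def laplaceTransform (μ : Measure (ℕ → ℝ≥0)) (s : ℕ →₀ ℝ≥0) : ℝ≥0∞ :=
  ∫⁻ y, ENNReal.ofReal (Real.exp (-pairing s y)) ∂μ

theorem laplaceTransform_zero (μ : Measure (ℕ → ℝ≥0)) :
    laplaceTransform μ 0 = μ Set.univ := by
  simp [laplaceTransform]

/-- Finiteness of `ν` comes for free: `s = 0` gives the total mass. -/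
theorem measure_ext_of_laplaceTransform {μ ν : Measure (ℕ → ℝ≥0)} [IsFiniteMeasure μ]
    (h : ∀ s, laplaceTransform μ s = laplaceTransform ν s) : μ = ν := by
  have : IsFiniteMeasure ν := ⟨by
    rw [← laplaceTransform_zero, ← h, laplaceTransform_zero]; exact measure_lt_top _ _⟩
  refine measure_ext_of_laplace fun s => ?_
  rw [integral_eq_lintegral_of_nonneg_ae (.of_forall fun _ => (Real.exp_pos _).le)
    (by fun_prop), integral_eq_lintegral_of_nonneg_ae (.of_forall fun _ => (Real.exp_pos _).le)
    (by fun_prop)]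
  exact congrArg _ (h s)

/-! ### Closure properties of Laplace transforms. -/

/-- A function is a Laplace transform if it is the (finite) Laplace transform of a measure on
sequences of nonnegative reals. -/
def IsLaplace (F : (ℕ →₀ ℝ≥0) → ℝ) : Prop :=
  ∃ τ : Measure (ℕ → ℝ≥0), ∀ s, 0 ≤ F s ∧ laplaceTransform τ s = ENNReal.ofReal (F s)

namespace IsLaplace

variable {F F' : (ℕ →₀ ℝ≥0) → ℝ}

theorem nonneg (h : IsLaplace F) (s : ℕ →₀ ℝ≥0) : 0 ≤ F s := (h.choose_spec s).1

theorem const {c : ℝ} (hc : 0 ≤ c) : IsLaplace fun _ => c :=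
  ⟨ENNReal.ofReal c • Measure.dirac 0, fun s => ⟨hc, by simp [laplaceTransform, pairing]⟩⟩

theorem add (h : IsLaplace F) (h' : IsLaplace F') : IsLaplace fun s => F s + F' s := by
  obtain ⟨τ, hτ⟩ := h
  obtain ⟨τ', hτ'⟩ := h'
  refine ⟨τ + τ', fun s => ⟨add_nonneg (hτ s).1 (hτ' s).1, ?_⟩⟩
  rw [ENNReal.ofReal_add (hτ s).1 (hτ' s).1, ← (hτ s).2, ← (hτ' s).2]
  simp [laplaceTransform]

/-- The representing measure is the convolution. -/
theorem mul (h : IsLaplace F) (h' : IsLaplace F') : IsLaplace fun s => F s * F' s := by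
  obtain ⟨τ, hτ⟩ := h
  obtain ⟨τ', hτ'⟩ := h'
  have : IsFiniteMeasure τ := ⟨by
    rw [← laplaceTransform_zero, (hτ 0).2]; exact ENNReal.ofReal_lt_top⟩
  have : IsFiniteMeasure τ' := ⟨by
    rw [← laplaceTransform_zero, (hτ' 0).2]; exact ENNReal.ofReal_lt_top⟩
  refine ⟨(τ.prod τ').map fun p => p.1 + p.2, fun s => ⟨mul_nonneg (hτ s).1 (hτ' s).1, ?_⟩⟩
  rw [ENNReal.ofReal_mul (hτ s).1, ← (hτ s).2, ← (hτ' s).2]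
  unfold laplaceTransform
  rw [lintegral_map (by fun_prop) (by fun_prop), ← lintegral_prod_mul (by fun_prop) (by fun_prop)]
  congr 1 with p
  rw [pairing_add_right, neg_add, Real.exp_add, ENNReal.ofReal_mul (Real.exp_pos _).le]

theorem const_mul (h : IsLaplace F) {c : ℝ} (hc : 0 ≤ c) : IsLaplace fun s => c * F s :=
  (const hc).mul h

theorem pow (h : IsLaplace F) (n : ℕ) : IsLaplace fun s => F s ^ n := by
  induction n with
  | zero => simpa using const zero_le_one
  | succ n ih => simpa only [pow_succ] using ih.mul h

/-- Together with `pow`, this gives stability under convergent power series with nonnegative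
coefficients. -/
theorem hasSum {ι : Type*} [Countable ι] {f : ι → (ℕ →₀ ℝ≥0) → ℝ} (h : ∀ i, IsLaplace (f i))
    (hF : ∀ s, HasSum (fun i => f i s) (F s)) : IsLaplace F := by
  choose τ hτ using h
  refine ⟨Measure.sum τ, fun s => ⟨(hF s).nonneg fun i => (hτ i s).1, ?_⟩⟩
  rw [← (hF s).tsum_eq, ENNReal.ofReal_tsum_of_nonneg (fun i => (hτ i s).1) (hF s).summable]
  unfold laplaceTransform
  rw [lintegral_sum_measure]
  exact tsum_congr fun i => (hτ i s).2

theorem tsum {ι : Type*} [Countable ι] {f : ι → (ℕ →₀ ℝ≥0) → ℝ} (h : ∀ i, IsLaplace (f i))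
    (hF : ∀ s, Summable (fun i => f i s)) : IsLaplace fun s => ∑' i, f i s :=
  hasSum h fun s => (hF s).hasSum

theorem inv_one_sub (h : IsLaplace F) (h1 : ∀ s, F s < 1) : IsLaplace fun s => (1 - F s)⁻¹ :=
  hasSum (fun n => h.pow n) fun s => hasSum_geometric_of_lt_one (h.nonneg s) (h1 s)

theorem exp_sub_one (h : IsLaplace F) : IsLaplace fun s => Real.exp (F s) - 1 := by
  refine hasSum (f := fun n s => (((n + 1).factorial : ℝ)⁻¹) * F s ^ (n + 1))
    (fun n => (h.pow _).const_mul (by positivity)) fun s => ?_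
  have := NormedSpace.expSeries_div_hasSum_exp (𝔸 := ℝ) (F s)
  rw [← Real.exp_eq_exp_ℝ] at this
  rw [← hasSum_nat_add_iff' 1] at this
  simpa [div_eq_inv_mul] using this

theorem neg_log_one_sub (h : IsLaplace F) (h1 : ∀ s, F s < 1) :
    IsLaplace fun s => -Real.log (1 - F s) := by
  refine hasSum (f := fun (n : ℕ) s => ((n + 1 : ℝ)⁻¹) * F s ^ (n + 1))
    (fun n => (h.pow _).const_mul (by positivity)) fun s => ?_
  have := Real.hasSum_pow_div_log_of_abs_lt_one (x := F s)
    (by rw [abs_of_nonneg (h.nonneg s)]; exact h1 s)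
  simpa [div_eq_inv_mul] using this

/-- As `exp (-α log (1 - F)) - 1`, this needs only the exponential and logarithmic series, both with
nonnegative coefficients. -/
theorem rpow_one_sub_sub_one (h : IsLaplace F) (h1 : ∀ s, F s < 1) {α : ℝ} (hα : 0 ≤ α) :
    IsLaplace fun s => (1 - F s) ^ (-α) - 1 := by
  convert ((h.neg_log_one_sub h1).const_mul hα).exp_sub_one using 3 with s
  rw [Real.rpow_def_of_pos (by linarith [h1 s])]
  congr 1; ring

/-- The Laplace transform of an exponential variable with mean `c` in one coordinate. -/
theorem inv_one_add_mul (i : ℕ) {c : ℝ} (hc : 0 < c) :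
    IsLaplace fun s => (1 + c * s i)⁻¹ := by
  refine ⟨((volume.restrict (Set.Ioi 0)).withDensity
    fun x : ℝ => ENNReal.ofReal (c⁻¹ * Real.exp (-(c⁻¹ * x)))).map
      fun x => Pi.single i x.toNNReal, fun s => ⟨by positivity, ?_⟩⟩
  have hm : Measurable fun x : ℝ => (Pi.single i x.toNNReal : ℕ → ℝ≥0) := by
    refine measurable_pi_iff.2 fun j => ?_
    by_cases hj : j = i
    · subst hj; simpa using measurable_real_toNNReal
    · simp [Pi.single_eq_of_ne hj]
  unfold laplaceTransform
  rw [lintegral_map (by fun_prop) hm, lintegral_withDensity_eq_lintegral_mul _ (by fun_prop)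
    (by fun_prop)]
  have hpos : 0 < c⁻¹ + s i := by positivity
  have key : ∫⁻ x in Set.Ioi (0 : ℝ),
      ENNReal.ofReal (c⁻¹ * Real.exp (-(c⁻¹ + s i) * x)) = ENNReal.ofReal ((1 + c * s i)⁻¹) := by
    rw [← ofReal_integral_eq_lintegral_ofReal
      ((integrableOn_exp_mul_Ioi (by linarith) 0).const_mul _)
      (.of_forall fun x => by positivity), integral_const_mul,
      integral_exp_mul_Ioi (by linarith)]
    congr 1
    simp only [mul_zero, Real.exp_zero]
    field_simp
  rw [← key]
  refine setLIntegral_congr_fun measurableSet_Ioi fun x hx => ?_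
  simp only [Pi.mul_apply, pairing_Pi_single, Real.coe_toNNReal _ (le_of_lt hx)]
  rw [← ENNReal.ofReal_mul (by positivity), mul_assoc, ← Real.exp_add]
  congr 3; ring

end IsLaplace

/-- If the Laplace transforms of two measures differ by a Laplace transform, then the measures are
ordered. -/
theorem le_of_laplaceTransform_eq {μ ν : Measure (ℕ → ℝ≥0)} [IsFiniteMeasure μ]
    {F : (ℕ →₀ ℝ≥0) → ℝ} (hF : IsLaplace F)
    (h : ∀ s, laplaceTransform μ s = laplaceTransform ν s + ENNReal.ofReal (F s)) : ν ≤ μ := by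
  obtain ⟨τ, hτ⟩ := hF
  have : μ = ν + τ := measure_ext_of_laplaceTransform fun s => by
    rw [h, ← (hτ s).2]; simp [laplaceTransform]
  rw [this]
  exact Measure.le_add_right le_rfl

/-! ### The Laplace transform of the permanental sequence. -/

/-- The determinant of `I + K S` for `K` a rank two perturbation of a diagonal matrix. -/
theorem det_one_add_mul_diagonal {ι : Type*} [Fintype ι] [DecidableEq ι] (l φ γ σ d : ι → ℝ)
    (h : ∀ i, 1 + l i * σ i ≠ 0) (hd : ∀ i, d i = σ i / (1 + l i * σ i)) :
    (1 + Matrix.of (fun i j => (if i = j then l i else 0) + 1 + φ i * γ j) *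
      Matrix.diagonal σ).det =
    (∏ i, (1 + l i * σ i)) * ((1 + ∑ i, d i) * (1 + ∑ i, φ i * γ i * d i) -
      (∑ i, φ i * d i) * ∑ i, γ i * d i) := by
  -- After factoring out the diagonal part, `det (1 + V W) = det (1 + W V)` leaves a 2 × 2
  -- determinant.
  let V : Matrix ι (Fin 2) ℝ := Matrix.of fun i => ![(1 + l i * σ i)⁻¹, φ i * (1 + l i * σ i)⁻¹]
  let W : Matrix (Fin 2) ι ℝ := Matrix.of ![σ, fun j => γ j * σ j]
  have hfac : (1 + Matrix.of (fun i j => (if i = j then l i else 0) + 1 + φ i * γ j) *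
      Matrix.diagonal σ) = Matrix.diagonal (fun i => 1 + l i * σ i) * (1 + V * W) := by
    ext i j
    have hi := h i
    rw [Matrix.add_apply, Matrix.mul_diagonal, Matrix.diagonal_mul, Matrix.add_apply,
      Matrix.mul_apply, Fin.sum_univ_two]
    simp only [Matrix.of_apply, V, W, Matrix.one_apply, Matrix.cons_val_zero, Matrix.cons_val_one]
    split_ifs with hij
    · subst hij; field_simp; ring
    · field_simp; ring
  rw [hfac, Matrix.det_mul, Matrix.det_diagonal, Matrix.det_one_add_mul_comm, Matrix.det_fin_two]
  congr 1
  have e1 : ∑ x, σ x * (1 + l x * σ x)⁻¹ = ∑ i, d i :=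
    Finset.sum_congr rfl fun i _ => by rw [hd]; ring
  have e2 : ∑ x, γ x * σ x * (φ x * (1 + l x * σ x)⁻¹) = ∑ i, φ i * γ i * d i :=
    Finset.sum_congr rfl fun i _ => by rw [hd]; ring
  have e3 : ∑ x, σ x * (φ x * (1 + l x * σ x)⁻¹) = ∑ i, φ i * d i :=
    Finset.sum_congr rfl fun i _ => by rw [hd]; ring
  have e4 : ∑ x, γ x * σ x * (1 + l x * σ x)⁻¹ = ∑ i, γ i * d i :=
    Finset.sum_congr rfl fun i _ => by rw [hd]; ring
  have hWV : W * V = !![∑ i, d i, ∑ i, φ i * d i; ∑ i, γ i * d i, ∑ i, φ i * γ i * d i] := by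
    ext a b
    fin_cases a <;> fin_cases b
    exacts [(Matrix.mul_apply ..).trans e1, (Matrix.mul_apply ..).trans e3,
      (Matrix.mul_apply ..).trans e4, (Matrix.mul_apply ..).trans e2]
  simp [hWV]

/-- The points `0, 1/N, 1/(N+1), …` of `T`. -/
noncomputable def tailPt (N : ℕ) : ℕ → T
  | 0 => zeroPt
  | i + 1 => invPt (N + i)

theorem idx_tailPt_zero (N : ℕ) : idx (tailPt N 0) = 0 := idx_zeroPt

theorem idx_tailPt_succ {N : ℕ} (hN : 2 ≤ N) (i : ℕ) : idx (tailPt N (i + 1)) = N + i :=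
  idx_invPt _ (by omega)

/-- Turns the Kronecker delta of the kernel into one in the positions, as `det_one_add_mul_diagonal`
requires. -/
theorem idx_tailPt_injective {N : ℕ} (hN : 2 ≤ N) :
    Function.Injective fun i => idx (tailPt N i) := by
  intro i j hij
  rcases i with _ | i <;> rcases j with _ | j <;>
    simp only [idx_tailPt_zero, idx_tailPt_succ hN] at hij <;> omega

/-- The factor `(1 + lam i * s (i + 1))⁻¹`. -/
noncomputable def uFac (lam : ℕ → ℝ) (s : ℕ →₀ ℝ≥0) (i : ℕ) : ℝ := (1 + lam i * s (i + 1))⁻¹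

/-- The process along the points `0, 1/N, 1/(N+1), …`, with values in the sequences of nonnegative
reals. -/
noncomputable def tailProcess {Ω : Type*} (X : T → Ω → ℝ) (N : ℕ) (ω : Ω) : ℕ → ℝ≥0 :=
  fun i => (X (tailPt N i) ω).toNNReal

variable {Ω : Type*} [MeasurableSpace Ω] {P : Measure Ω}
  {lam f g : ℕ → ℝ} {α : ℝ} {X : T → Ω → ℝ}

theorem aemeasurable_tailProcess (hX : IsPermanental P α (U lam f g) X) (N : ℕ) :
    AEMeasurable (tailProcess X N) P :=
  aemeasurable_pi_lambda _ fun _ => (hX.aemeasurable _).real_toNNReal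

/-- The Laplace transform of the process along the points `0, 1/N, 1/(N+1), …`. -/
theorem laplaceTransform_tailProcess [IsProbabilityMeasure P] (h : Admissible lam f g)
    (hX : IsPermanental P α (U lam f g) X)
    {N : ℕ} (hN : 2 ≤ N) (s : ℕ →₀ ℝ≥0) {n : ℕ} (hn : ∀ i, n ≤ i → s (i + 1) = 0)
    {d : ℕ → ℝ} (hd : ∀ i, d i = s (i + 1) / (1 + lam (N + i) * s (i + 1))) :
    laplaceTransform (P.map (tailProcess X N)) s = ENNReal.ofReal
      (1 / ((∏ i ∈ Finset.range n, (1 + lam (N + i) * s (i + 1))) *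
      ((1 + s 0 + ∑ i ∈ Finset.range n, d i) *
        (1 + s 0 + ∑ i ∈ Finset.range n, f (N + i) * g (N + i) * d i) -
        (s 0 + ∑ i ∈ Finset.range n, f (N + i) * d i) *
          (s 0 + ∑ i ∈ Finset.range n, g (N + i) * d i))) ^ α) := by
  have hpos : ∀ i, 0 < 1 + lam (idx (tailPt N i)) * s i := by
    rintro (_ | i)
    · simp [idx_tailPt_zero, h.lam_zero]
    · rw [idx_tailPt_succ hN]
      have := h.lam_pos (N + i) (by omega)
      positivity
  have key := hX.laplace (n + 1) (fun i => tailPt N i) (fun i => s i) (fun i => by positivity)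
  have hdet := det_one_add_mul_diagonal (ι := Fin (n + 1)) (fun i => lam (idx (tailPt N i)))
    (fun i => f (idx (tailPt N i))) (fun i => g (idx (tailPt N i))) (fun i => (s i : ℝ))
    (fun i => s i / (1 + lam (idx (tailPt N i)) * s i)) (fun i => (hpos i).ne') (fun i => rfl)
  have hK : (Matrix.of fun i j : Fin (n + 1) => U lam f g (tailPt N i) (tailPt N j)) =
      Matrix.of fun i j : Fin (n + 1) => (if i = j then lam (idx (tailPt N i)) else 0) + 1 +
        f (idx (tailPt N i)) * g (idx (tailPt N j)) := by
    ext i j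
    simp only [U, G, Matrix.of_apply, (idx_tailPt_injective hN).eq_iff, Fin.val_inj]
  -- Position `0` splits off: there `lam = 0` and `f = g = 1`, so it adds `s 0` to each of the four
  -- sums and a factor `1` to the product.
  rw [hK, hdet, Fin.sum_univ_succ, Fin.sum_univ_succ, Fin.sum_univ_succ, Fin.sum_univ_succ,
    Fin.prod_univ_succ] at key
  simp only [Fin.val_zero, Fin.val_succ, idx_tailPt_zero, idx_tailPt_succ hN, h.lam_zero,
    h.f_zero, h.g_zero, ← hd, zero_mul, add_zero, div_one, one_mul] at key
  simp only [Fin.sum_univ_eq_sum_range (fun i => d i),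
    Fin.sum_univ_eq_sum_range (fun i => f (N + i) * g (N + i) * d i),
    Fin.sum_univ_eq_sum_range (fun i => f (N + i) * d i),
    Fin.sum_univ_eq_sum_range (fun i => g (N + i) * d i),
    Fin.prod_univ_eq_prod_range (fun i => 1 + lam (N + i) * (s (i + 1) : ℝ)), ← add_assoc] at key
  rw [← key, laplaceTransform, lintegral_map' (by fun_prop) (aemeasurable_tailProcess hX N),
    ofReal_integral_eq_lintegral_ofReal]
  · refine lintegral_congr_ae ?_
    filter_upwards [ae_all_iff.2 fun i => hX.nonneg (tailPt N i)] with ω hω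
    rw [pairing_eq_sum s _ (n := n + 1) fun i hi => by
        obtain ⟨j, rfl⟩ := Nat.exists_eq_succ_of_ne_zero (n := i) (by omega)
        exact hn j (by omega), ← Fin.sum_univ_eq_sum_range fun i => (s i : ℝ) * tailProcess X N ω i]
    simp only [tailProcess, Real.coe_toNNReal _ (hω _)]
  · have hm : AEMeasurable (fun ω => Real.exp (-∑ i : Fin (n + 1), (s i : ℝ) * X (tailPt N i) ω))
        P := by
      have := fun i => hX.aemeasurable (tailPt N i)
      fun_prop
    refine Integrable.of_bound hm.aestronglyMeasurable 1 ?_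
    filter_upwards [ae_all_iff.2 fun i => hX.nonneg (tailPt N i)] with ω hω
    rw [Real.norm_eq_abs, Real.abs_exp, Real.exp_le_one_iff, neg_nonpos]
    exact Finset.sum_nonneg fun i _ => mul_nonneg (by positivity) (hω _)
  · exact .of_forall fun _ => (Real.exp_pos _).le

namespace IsLaplace

theorem of_ne_top {τ : Measure (ℕ → ℝ≥0)} (h : ∀ s, laplaceTransform τ s ≠ ∞) :
    IsLaplace fun s => (laplaceTransform τ s).toReal :=
  ⟨τ, fun s => ⟨ENNReal.toReal_nonneg, (ENNReal.ofReal_toReal (h s)).symm⟩⟩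

/-- The change of a Laplace transform under an exponential tilt of the first coordinate by a
Laplace transform is a Laplace transform. -/
theorem tilt_sub {ν : Measure (ℕ → ℝ≥0)} {K : ℝ} (hK : 0 < K)
    (hfin : ∫⁻ y, ENNReal.ofReal (Real.exp (K * y 0)) ∂ν ≠ ∞)
    {R : (ℕ →₀ ℝ≥0) → ℝ} (hR : IsLaplace R) (hRK : ∀ s, R s ≤ K) :
    IsLaplace fun s => (∫⁻ y, ENNReal.ofReal (Real.exp (-pairing s y + R s * y 0)) ∂ν).toReal -
      (laplaceTransform ν s).toReal := by
  -- The tilt `R s` varies with `s`, so a single change of density does not suffice. Expanding `exp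
  -- (R s * y 0)` gives `∑ R s ^ k` times the transform of `ν` weighted by `y 0 ^ k / k!`; the term
  -- `k = 0` is the one subtracted.
  let w : ℕ → (ℕ → ℝ≥0) → ℝ≥0∞ := fun k y => ENNReal.ofReal ((y 0 : ℝ) ^ k / k.factorial)
  have hw : ∀ k, Measurable (w k) := fun k => by
    refine ENNReal.measurable_ofReal.comp ?_
    fun_prop
  let τ : ℕ → Measure (ℕ → ℝ≥0) := fun k => ν.withDensity (w k)
  have hτ : ∀ k s, laplaceTransform (τ k) s =
      ∫⁻ y, w k y * ENNReal.ofReal (Real.exp (-pairing s y)) ∂ν := fun k s => by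
    rw [laplaceTransform, lintegral_withDensity_eq_lintegral_mul _ (hw k) (by fun_prop)]
    rfl
  have hexp : ∀ (r : ℝ), 0 ≤ r → ∀ s, ∫⁻ y, ENNReal.ofReal (Real.exp (-pairing s y + r * y 0)) ∂ν =
      ∑' k, ENNReal.ofReal (r ^ k) * laplaceTransform (τ k) s := by
    intro r hr s
    simp only [hτ]
    have : ∀ k, ENNReal.ofReal (r ^ k) *
        ∫⁻ y, w k y * ENNReal.ofReal (Real.exp (-pairing s y)) ∂ν =
        ∫⁻ y, ENNReal.ofReal (r ^ k) * (w k y * ENNReal.ofReal (Real.exp (-pairing s y))) ∂ν :=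
      fun k => (lintegral_const_mul _ ((hw k).mul (by fun_prop))).symm
    simp only [this]
    rw [← lintegral_tsum (f := fun k y => ENNReal.ofReal (r ^ k) *
      (w k y * ENNReal.ofReal (Real.exp (-pairing s y))))
      fun k => (((hw k).mul (by fun_prop)).const_mul _).aemeasurable]
    congr 1 with y
    have hs := NormedSpace.expSeries_div_hasSum_exp (𝔸 := ℝ) (r * y 0)
    rw [← Real.exp_eq_exp_ℝ] at hs
    simp only [w, ← mul_assoc]
    rw [ENNReal.tsum_mul_right, add_comm, Real.exp_add, ENNReal.ofReal_mul (Real.exp_pos _).le,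
      ← hs.tsum_eq, ENNReal.ofReal_tsum_of_nonneg (fun k => by positivity) hs.summable]
    congr 2 with k
    rw [← ENNReal.ofReal_mul (by positivity), mul_pow, mul_div_assoc]
  have hKs : ∀ s, ∫⁻ y, ENNReal.ofReal (Real.exp (-pairing s y + K * y 0)) ∂ν ≠ ∞ := fun s =>
    ne_top_of_le_ne_top hfin <| lintegral_mono fun y => ENNReal.ofReal_le_ofReal <|
      Real.exp_le_exp.2 <| by linarith [pairing_nonneg s y]
  -- Each weighted measure has a finite transform because, times `K ^ k > 0`, it is one term of a
  -- finite series.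
  have htop : ∀ k s, laplaceTransform (τ k) s ≠ ∞ := by
    intro k s
    have h1 := hKs s
    rw [hexp K hK.le s] at h1
    have h2 := ENNReal.ne_top_of_tsum_ne_top h1 k
    exact fun h => h2 (by rw [h, ENNReal.mul_top (by simp; positivity)])
  have h0 : τ 0 = ν := by simp [τ, w]
  refine hasSum (f := fun (k : ℕ) s => R s ^ (k + 1) * (laplaceTransform (τ (k + 1)) s).toReal)
    (fun k => (hR.pow _).mul (of_ne_top (htop _))) fun s => ?_
  have h1 : ∫⁻ y, ENNReal.ofReal (Real.exp (-pairing s y + R s * y 0)) ∂ν ≠ ∞ :=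
    ne_top_of_le_ne_top (hKs s) <| lintegral_mono fun y => ENNReal.ofReal_le_ofReal <|
      Real.exp_le_exp.2 <| by gcongr; exact hRK s
  rw [hexp _ (hR.nonneg s)] at h1 ⊢
  have h2 := ENNReal.hasSum_toReal h1
  rw [← ENNReal.tsum_toReal_eq (ENNReal.ne_top_of_tsum_ne_top h1), ← hasSum_nat_add_iff' 1] at h2
  simpa [ENNReal.toReal_mul, ENNReal.toReal_ofReal, hR.nonneg s, h0, pow_nonneg] using h2

end IsLaplace

/-! ### Factorization of the determinant and comparison of laws. -/

/-- Sequences `lam`, `a`, `b` as obtained by setting `a = 1 - f` and `b = 1 - g`. -/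
structure DefectData (lam a b : ℕ → ℝ) : Prop where
  lam_pos : ∀ i, 0 < lam i
  a_nonneg : ∀ i, 0 ≤ a i
  a_le : ∀ i, a i ≤ 1
  b_nonneg : ∀ i, 0 ≤ b i
  b_le : ∀ i, b i ≤ 1
  a_summable : Summable fun i => a i / lam i
  b_summable : Summable fun i => b i / lam i
  a_sum_le : ∑' i, a i / lam i ≤ 1
  b_sum_le : ∑' i, b i / lam i ≤ 1

/-- `1 + ∑ a i / lam i`. -/
noncomputable def sumOne (lam a : ℕ → ℝ) : ℝ := 1 + ∑' i, a i / lam i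

/-- `2 + ∑ a i * b i / lam i`. -/
noncomputable def sumTwo (lam a b : ℕ → ℝ) : ℝ := 2 + ∑' i, a i * b i / lam i

/-- The rate of the first coordinate of the comparison process. -/
noncomputable def rate (lam a b : ℕ → ℝ) : ℝ :=
  1 + 2 * sumOne lam a * sumOne lam b / sumTwo lam a b ^ 2 - sumOne lam a / sumTwo lam a b -
    sumOne lam b / sumTwo lam a b

/-- The damping factors of the comparison process. -/
noncomputable def damp (lam a b : ℕ → ℝ) (i : ℕ) : ℝ :=
  (1 - sumOne lam a / sumTwo lam a b * b i) * (1 - sumOne lam b / sumTwo lam a b * a i)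

/-- The sum `∑ c i * u i` with `u i = (1 + lam i * s (i + 1))⁻¹`. -/
noncomputable def uSum (lam c : ℕ → ℝ) (s : ℕ →₀ ℝ≥0) : ℝ := ∑' i, c i * uFac lam s i

section uSum

variable {lam : ℕ → ℝ} (hl : ∀ i, 0 < lam i)
include hl

theorem uFac_pos (s : ℕ →₀ ℝ≥0) (i : ℕ) : 0 < uFac lam s i := by
  have := hl i
  unfold uFac; positivity

theorem uFac_le_one (s : ℕ →₀ ℝ≥0) (i : ℕ) : uFac lam s i ≤ 1 := by
  have := hl i
  exact inv_le_one_of_one_le₀ (by have : 0 ≤ lam i * s (i + 1) := by positivity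
                                  linarith)

theorem summable_mul_uFac {c : ℕ → ℝ} (hs : Summable c) (s : ℕ →₀ ℝ≥0) :
    Summable fun i => c i * uFac lam s i := by
  refine Summable.of_norm_bounded hs.norm fun i => ?_
  rw [norm_mul, Real.norm_of_nonneg (uFac_pos hl s i).le]
  exact mul_le_of_le_one_right (norm_nonneg _) (uFac_le_one hl s i)

theorem isLaplace_uSum {c : ℕ → ℝ} (hc : ∀ i, 0 ≤ c i) (hs : Summable c) :
    IsLaplace (uSum lam c) :=
  IsLaplace.tsum (fun i => (IsLaplace.inv_one_add_mul (i + 1) (hl i)).const_mul (hc i))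
    (summable_mul_uFac hl hs)

theorem uSum_le {c : ℕ → ℝ} (hc : ∀ i, 0 ≤ c i) (hs : Summable c) (s : ℕ →₀ ℝ≥0) :
    uSum lam c s ≤ ∑' i, c i :=
  (summable_mul_uFac hl hs s).tsum_le_tsum
    (fun i => mul_le_of_le_one_right (hc i) (uFac_le_one hl s i)) hs

/-- Since `lam i * d i = 1 - uFac lam s i`, a finite sum in `d` is a constant minus a series in
`uFac`; the terms from `n` on cancel because there `uFac = 1`. -/
theorem sum_mul_eq_tsum_sub_uSum {c : ℕ → ℝ} (hs : Summable fun i => c i / lam i)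
    (s : ℕ →₀ ℝ≥0) {n : ℕ} (hn : ∀ i, n ≤ i → s (i + 1) = 0) {d : ℕ → ℝ}
    (hd : ∀ i, d i = s (i + 1) / (1 + lam i * s (i + 1))) :
    ∑ i ∈ Finset.range n, c i * d i = ∑' i, c i / lam i - uSum lam (fun i => c i / lam i) s := by
  rw [uSum, ← hs.tsum_sub (summable_mul_uFac hl hs s), tsum_eq_sum (s := Finset.range n)]
  · refine Finset.sum_congr rfl fun i _ => ?_
    have := hl i
    have : 0 < 1 + lam i * s (i + 1) := by positivity
    rw [hd, uFac]
    field_simp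
    ring
  · intro i hi
    simp [uFac, hn i (by simpa using hi)]

end uSum

/-- The terms quadratic in `s0 + D` cancel, leaving `(M - ru) (s0 + D + 1) - (P - pu) (Q - qu)`.
Substituting `P - pu = (P/M) (M - ru) - (pu - (P/M) ru)`, and likewise for `Q`, splits `(P - pu) (Q
- qu) / (M - ru)` into a part affine in `A, B, C` and the quadratic remainder. -/
theorem tilt_identity {P Q M D A B C s0 pu qu ru : ℝ} (hM : M ≠ 0) (hMr : M - ru ≠ 0)
    (hA : A = P - 1 - pu) (hB : B = Q - 1 - qu) (hC : C = M - 2 - ru) :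
    (1 + s0 + D) * (1 + s0 + (D - A - B + C)) - (s0 + (D - A)) * (s0 + (D - B)) =
    (M - ru) * (s0 + (1 + 2 * P * Q / M ^ 2 - P / M - Q / M) +
      (D - P / M * B - Q / M * A + P * Q / M ^ 2 * C) -
      (pu - P / M * ru) * (qu - Q / M * ru) / (M - ru)) := by
  subst hA hB hC
  field_simp
  ring

namespace DefectData

variable {lam a b : ℕ → ℝ} (h : DefectData lam a b)
include h

theorem symm : DefectData lam b a :=
  ⟨h.lam_pos, h.b_nonneg, h.b_le, h.a_nonneg, h.a_le, h.b_summable, h.a_summable, h.b_sum_le,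
    h.a_sum_le⟩

omit h in
theorem sumTwo_comm : sumTwo lam a b = sumTwo lam b a := by
  simp only [sumTwo, mul_comm]

theorem ab_summable : Summable fun i => a i * b i / lam i :=
  h.a_summable.of_nonneg_of_le
    (fun i => div_nonneg (mul_nonneg (h.a_nonneg i) (h.b_nonneg i)) (h.lam_pos i).le)
    fun i => by
      have := h.lam_pos i
      gcongr
      exact mul_le_of_le_one_right (h.a_nonneg i) (h.b_le i)

theorem two_le_sumTwo : 2 ≤ sumTwo lam a b := by
  have : 0 ≤ ∑' i, a i * b i / lam i := tsum_nonneg fun i =>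
    div_nonneg (mul_nonneg (h.a_nonneg i) (h.b_nonneg i)) (h.lam_pos i).le
  unfold sumTwo; linarith

theorem one_le_sumOne : 1 ≤ sumOne lam a := by
  have : 0 ≤ ∑' i, a i / lam i := tsum_nonneg fun i => div_nonneg (h.a_nonneg i) (h.lam_pos i).le
  unfold sumOne; linarith

/-- The bound `1` on the sum enters here, through `sumOne ≤ 2 ≤ sumTwo`; it makes the damping
factors and the coefficients in `quadPart` nonnegative. -/
theorem ratio_le_one : sumOne lam a / sumTwo lam a b ≤ 1 := by
  rw [div_le_one (by linarith [h.two_le_sumTwo])]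
  have := h.a_sum_le
  have := h.two_le_sumTwo
  unfold sumOne; linarith

theorem one_sub_nonneg (i : ℕ) : 0 ≤ 1 - sumOne lam a / sumTwo lam a b * b i := by
  have := mul_le_one₀ h.ratio_le_one (h.b_nonneg i) (h.b_le i)
  linarith

theorem damp_nonneg (i : ℕ) : 0 ≤ damp lam a b i :=
  mul_nonneg (h.one_sub_nonneg i) (by simpa [sumTwo_comm (a := a)] using h.symm.one_sub_nonneg i)

/-- The coefficients of the linear form in `quadPart` are nonnegative. -/
theorem coeff_nonneg (i : ℕ) :
    0 ≤ a i / lam i - sumOne lam a / sumTwo lam a b * (a i * b i / lam i) := by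
  have := mul_nonneg (div_nonneg (h.a_nonneg i) (h.lam_pos i).le) (h.one_sub_nonneg i)
  rwa [mul_sub, mul_one, show a i / lam i * (sumOne lam a / sumTwo lam a b * b i) =
    sumOne lam a / sumTwo lam a b * (a i * b i / lam i) by ring] at this

theorem coeff_summable :
    Summable fun i => a i / lam i - sumOne lam a / sumTwo lam a b * (a i * b i / lam i) :=
  h.a_summable.sub (h.ab_summable.mul_left _)

theorem tsum_coeff :
    ∑' i, (a i / lam i - sumOne lam a / sumTwo lam a b * (a i * b i / lam i)) =
      2 * (sumOne lam a / sumTwo lam a b) - 1 := by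
  rw [h.a_summable.tsum_sub (h.ab_summable.mul_left _), tsum_mul_left]
  have h1 : ∑' i, a i / lam i = sumOne lam a - 1 := by simp [sumOne]
  have h2 : ∑' i, a i * b i / lam i = sumTwo lam a b - 2 := by simp [sumTwo]
  have := h.two_le_sumTwo
  have : sumTwo lam a b ≠ 0 := by positivity
  rw [h1, h2]; field_simp; ring

theorem uSum_coeff (s : ℕ →₀ ℝ≥0) :
    uSum lam (fun i => a i / lam i - sumOne lam a / sumTwo lam a b * (a i * b i / lam i)) s =
      uSum lam (fun i => a i / lam i) s -
        sumOne lam a / sumTwo lam a b * uSum lam (fun i => a i * b i / lam i) s := by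
  simp only [uSum, sub_mul]
  rw [(summable_mul_uFac h.lam_pos h.a_summable s).tsum_sub (by
    simpa only [mul_assoc] using (summable_mul_uFac h.lam_pos h.ab_summable s).mul_left
      (sumOne lam a / sumTwo lam a b))]
  simp only [mul_assoc, tsum_mul_left]

theorem two_le_sumTwo_sub (s : ℕ →₀ ℝ≥0) :
    2 ≤ sumTwo lam a b - uSum lam (fun i => a i * b i / lam i) s := by
  have := uSum_le h.lam_pos (fun i => div_nonneg (mul_nonneg (h.a_nonneg i) (h.b_nonneg i))
    (h.lam_pos i).le) h.ab_summable s
  unfold sumTwo; linarith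

end DefectData

/-- The quadratic part of the interaction. -/
noncomputable def quadPart (lam a b : ℕ → ℝ) (s : ℕ →₀ ℝ≥0) : ℝ :=
  uSum lam (fun i => a i / lam i - sumOne lam a / sumTwo lam a b * (a i * b i / lam i)) s *
  uSum lam (fun i => b i / lam i - sumOne lam b / sumTwo lam b a * (b i * a i / lam i)) s /
    (sumTwo lam a b - uSum lam (fun i => a i * b i / lam i) s)

namespace DefectData

variable {lam a b : ℕ → ℝ} (h : DefectData lam a b)
include h

theorem isLaplace_uSum_ab : IsLaplace (uSum lam fun i => a i * b i / lam i) :=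
  isLaplace_uSum h.lam_pos (fun i => div_nonneg (mul_nonneg (h.a_nonneg i) (h.b_nonneg i))
    (h.lam_pos i).le) h.ab_summable

theorem isLaplace_ratio :
    IsLaplace fun s => (sumTwo lam a b)⁻¹ * uSum lam (fun i => a i * b i / lam i) s :=
  h.isLaplace_uSum_ab.const_mul (inv_nonneg.2 (by linarith [h.two_le_sumTwo]))

theorem ratio_lt_one (s : ℕ →₀ ℝ≥0) :
    (sumTwo lam a b)⁻¹ * uSum lam (fun i => a i * b i / lam i) s < 1 := by
  rw [inv_mul_eq_div, div_lt_one (by linarith [h.two_le_sumTwo])]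
  linarith [h.two_le_sumTwo_sub s]

/-- The denominator `M - r = M (1 - r/M)` is inverted by a geometric series; the numerator is a
product of Laplace transforms. -/
theorem isLaplace_quadPart : IsLaplace (quadPart lam a b) := by
  have h1 := isLaplace_uSum h.lam_pos h.coeff_nonneg h.coeff_summable
  have h2 := isLaplace_uSum h.lam_pos h.symm.coeff_nonneg h.symm.coeff_summable
  have h3 := h.isLaplace_ratio.inv_one_sub h.ratio_lt_one
  have hM := h.two_le_sumTwo
  convert ((h1.mul h2).mul h3).const_mul (inv_nonneg.2 (by linarith : 0 ≤ sumTwo lam a b))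
    using 2 with s
  have h4 := h.two_le_sumTwo_sub s
  have h5 : sumTwo lam a b * (1 - (sumTwo lam a b)⁻¹ * uSum lam (fun i => a i * b i / lam i) s) =
      sumTwo lam a b - uSum lam (fun i => a i * b i / lam i) s := by
    field_simp
  rw [quadPart, ← h5, div_eq_mul_inv, mul_inv]; ring

/-- The bound is the value at `s = 0`, where the numerator is largest and the denominator is `2`.
The gap `1/2` leaves room for an exponential moment of the comparison process. -/
theorem quadPart_le (s : ℕ →₀ ℝ≥0) : quadPart lam a b s ≤ rate lam a b - 1 / 2 := by
  have h1 := uSum_le h.lam_pos h.coeff_nonneg h.coeff_summable s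
  have h2 := uSum_le h.lam_pos h.symm.coeff_nonneg h.symm.coeff_summable s
  have h1' := (isLaplace_uSum h.lam_pos h.coeff_nonneg h.coeff_summable).nonneg s
  have h2' := (isLaplace_uSum h.lam_pos h.symm.coeff_nonneg h.symm.coeff_summable).nonneg s
  rw [h.tsum_coeff] at h1
  rw [h.symm.tsum_coeff] at h2
  have h3 : rate lam a b - 1 / 2 = (2 * (sumOne lam a / sumTwo lam a b) - 1) *
      (2 * (sumOne lam b / sumTwo lam b a) - 1) / 2 := by
    rw [rate, sumTwo_comm (a := b)]
    have := h.two_le_sumTwo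
    field_simp; ring
  rw [h3]
  exact div_le_div₀ (mul_nonneg (h1'.trans h1) (h2'.trans h2)) (mul_le_mul h1 h2 h2' (h1'.trans h1))
    two_pos (h.two_le_sumTwo_sub s)

theorem half_le_rate : 1 / 2 ≤ rate lam a b := by
  linarith [h.quadPart_le 0, h.isLaplace_quadPart.nonneg 0]

/-- The factorization of the determinant. -/
theorem det_factor (s : ℕ →₀ ℝ≥0) {n : ℕ} (hn : ∀ i, n ≤ i → s (i + 1) = 0) {d : ℕ → ℝ}
    (hd : ∀ i, d i = s (i + 1) / (1 + lam i * s (i + 1))) :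
    (1 + s 0 + ∑ i ∈ Finset.range n, d i) *
        (1 + s 0 + ∑ i ∈ Finset.range n, (1 - a i) * (1 - b i) * d i) -
        (s 0 + ∑ i ∈ Finset.range n, (1 - a i) * d i) *
          (s 0 + ∑ i ∈ Finset.range n, (1 - b i) * d i) =
    sumTwo lam a b * (1 - (sumTwo lam a b)⁻¹ * uSum lam (fun i => a i * b i / lam i) s) *
      (s 0 + rate lam a b + ∑ i ∈ Finset.range n, damp lam a b i * d i - quadPart lam a b s) := by
  have hM := h.two_le_sumTwo
  have hMr := h.two_le_sumTwo_sub s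
  have hA := sum_mul_eq_tsum_sub_uSum h.lam_pos h.a_summable s hn hd
  have hB := sum_mul_eq_tsum_sub_uSum h.lam_pos h.b_summable s hn hd
  have hC := sum_mul_eq_tsum_sub_uSum h.lam_pos h.ab_summable s hn hd
  have e1 : ∑ i ∈ Finset.range n, (1 - a i) * (1 - b i) * d i =
      ∑ i ∈ Finset.range n, d i - ∑ i ∈ Finset.range n, a i * d i -
        ∑ i ∈ Finset.range n, b i * d i + ∑ i ∈ Finset.range n, a i * b i * d i := by
    rw [← Finset.sum_sub_distrib, ← Finset.sum_sub_distrib, ← Finset.sum_add_distrib]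
    exact Finset.sum_congr rfl fun i _ => by ring
  have e2 : ∀ c : ℕ → ℝ, ∑ i ∈ Finset.range n, (1 - c i) * d i =
      ∑ i ∈ Finset.range n, d i - ∑ i ∈ Finset.range n, c i * d i := fun c => by
    rw [← Finset.sum_sub_distrib]
    exact Finset.sum_congr rfl fun i _ => by ring
  have e3 : ∑ i ∈ Finset.range n, damp lam a b i * d i = ∑ i ∈ Finset.range n, d i -
      sumOne lam a / sumTwo lam a b * ∑ i ∈ Finset.range n, b i * d i -
      sumOne lam b / sumTwo lam a b * ∑ i ∈ Finset.range n, a i * d i +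
      sumOne lam a * sumOne lam b / sumTwo lam a b ^ 2 *
        ∑ i ∈ Finset.range n, a i * b i * d i := by
    simp only [Finset.mul_sum, damp]
    rw [← Finset.sum_sub_distrib, ← Finset.sum_sub_distrib, ← Finset.sum_add_distrib]
    exact Finset.sum_congr rfl fun i _ => by ring
  rw [e1, e2, e2, e3, quadPart, h.uSum_coeff, h.symm.uSum_coeff, sumTwo_comm (a := b), rate]
  simp only [mul_comm (b _) (a _)]
  rw [tilt_identity (P := sumOne lam a) (Q := sumOne lam b) (M := sumTwo lam a b)
    (pu := uSum lam (fun i => a i / lam i) s) (qu := uSum lam (fun i => b i / lam i) s)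
    (ru := uSum lam (fun i => a i * b i / lam i) s) (by positivity) (by positivity)
    (by rw [hA, sumOne]; ring) (by rw [hB, sumOne]; ring) (by rw [hC, sumTwo]; ring)]
  congr 1
  field_simp

/-- Comparison with the process whose tilted Laplace transforms are given. -/
theorem smul_le {α : ℝ} (hα : 0 ≤ α) {μ ν : Measure (ℕ → ℝ≥0)} [IsFiniteMeasure μ]
    (hμ : ∀ (s : ℕ →₀ ℝ≥0) (n : ℕ) (d : ℕ → ℝ), (∀ i, n ≤ i → s (i + 1) = 0) →
      (∀ i, d i = s (i + 1) / (1 + lam i * s (i + 1))) →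
      laplaceTransform μ s = ENNReal.ofReal
      (1 / ((∏ i ∈ Finset.range n, (1 + lam i * s (i + 1))) *
        ((1 + s 0 + ∑ i ∈ Finset.range n, d i) *
        (1 + s 0 + ∑ i ∈ Finset.range n, (1 - a i) * (1 - b i) * d i) -
        (s 0 + ∑ i ∈ Finset.range n, (1 - a i) * d i) *
          (s 0 + ∑ i ∈ Finset.range n, (1 - b i) * d i))) ^ α))
    (hν : ∀ (s : ℕ →₀ ℝ≥0) (n : ℕ) (d : ℕ → ℝ) (R : ℝ), (∀ i, n ≤ i → s (i + 1) = 0) →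
      (∀ i, d i = s (i + 1) / (1 + lam i * s (i + 1))) → R < rate lam a b →
      ∫⁻ y, ENNReal.ofReal (Real.exp (-pairing s y + R * y 0)) ∂ν = ENNReal.ofReal
      ((rate lam a b / ((∏ i ∈ Finset.range n, (1 + lam i * s (i + 1))) *
        (s 0 + rate lam a b + ∑ i ∈ Finset.range n, damp lam a b i * d i - R))) ^ α)) :
    ENNReal.ofReal ((sumTwo lam a b * rate lam a b) ^ (-α)) • ν ≤ μ := by
  have hM := h.two_le_sumTwo
  have hκ := h.half_le_rate
  set c := (sumTwo lam a b * rate lam a b) ^ (-α) with hc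
  have hc0 : 0 ≤ c := by positivity
  set V : (ℕ →₀ ℝ≥0) → ℝ≥0∞ := fun s =>
    ∫⁻ y, ENNReal.ofReal (Real.exp (-pairing s y + quadPart lam a b s * y 0)) ∂ν with hV
  have hlt : ∀ s, quadPart lam a b s < rate lam a b := fun s => by linarith [h.quadPart_le s]
  have hex : ∀ s : ℕ →₀ ℝ≥0, ∃ n, ∀ i, n ≤ i → s (i + 1) = 0 := fun s => by
    refine ⟨s.support.sup id, fun i hi => ?_⟩
    by_contra hne
    have := Finset.le_sup (f := id) (Finsupp.mem_support_iff.2 hne)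
    simp only [id] at this
    omega
  have hVtop : ∀ s, V s ≠ ∞ := fun s => by
    obtain ⟨n, hn⟩ := hex s
    rw [hV]; simp only
    rw [hν s n _ _ hn (fun _ => rfl) (hlt s)]
    exact ENNReal.ofReal_ne_top
  have hLtop : ∀ s, laplaceTransform ν s ≠ ∞ := fun s => by
    obtain ⟨n, hn⟩ := hex s
    have := hν s n _ 0 hn (fun _ => rfl) (by linarith)
    simp only [zero_mul, add_zero] at this
    rw [laplaceTransform, this]
    exact ENNReal.ofReal_ne_top
  have hL : IsLaplace fun s => (laplaceTransform ν s).toReal := IsLaplace.of_ne_top hLtop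
  have hV2 : IsLaplace fun s => (V s).toReal - (laplaceTransform ν s).toReal := by
    -- `K` must be positive, dominate `quadPart ≤ rate - 1/2`, and stay below `rate` so that the
    -- moment is finite.
    refine IsLaplace.tilt_sub (K := rate lam a b - 1 / 4) (by linarith) ?_ h.isLaplace_quadPart
      fun s => by linarith [h.quadPart_le s]
    have := hν 0 0 (fun _ => 0) (rate lam a b - 1 / 4) (by simp) (by simp) (by linarith)
    simp only [pairing_zero, neg_zero, zero_add] at this
    rw [this]
    exact ENNReal.ofReal_ne_top
  have hH := h.isLaplace_ratio.rpow_one_sub_sub_one h.ratio_lt_one hα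
  -- The transform of `μ` is `c H V` with `H = (1 - r/M)^(-α)`. It exceeds `c L`, where `L` is the
  -- transform of `ν`, by `c (V - L) + c (H - 1) V`, a Laplace transform; `V` is written `L + (V -
  -- L)` to reuse known cases.
  refine le_of_laplaceTransform_eq
    ((hV2.const_mul hc0).add ((hH.mul (hL.add hV2)).const_mul hc0)) fun s => ?_
  have hlap : laplaceTransform (ENNReal.ofReal c • ν) s =
      ENNReal.ofReal (c * (laplaceTransform ν s).toReal) := by
    rw [ENNReal.ofReal_mul hc0, ENNReal.ofReal_toReal (hLtop s)]
    simp [laplaceTransform]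
  rw [hlap, ← ENNReal.ofReal_add (mul_nonneg hc0 ENNReal.toReal_nonneg)
    (((hV2.const_mul hc0).add ((hH.mul (hL.add hV2)).const_mul hc0)).nonneg s)]
  obtain ⟨n, hn⟩ := hex s
  have hd0 : ∀ i, (0 : ℝ) ≤ s (i + 1) / (1 + lam i * s (i + 1)) := fun i => by
    have := h.lam_pos i; positivity
  have hVs : (V s).toReal = (rate lam a b / ((∏ i ∈ Finset.range n, (1 + lam i * s (i + 1))) *
      (s 0 + rate lam a b + ∑ i ∈ Finset.range n,
        damp lam a b i * (s (i + 1) / (1 + lam i * s (i + 1))) - quadPart lam a b s))) ^ α := by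
    rw [hV]; simp only
    rw [hν s n _ _ hn (fun _ => rfl) (hlt s), ENNReal.toReal_ofReal]
    refine Real.rpow_nonneg (div_nonneg (by linarith) (mul_nonneg
      (Finset.prod_nonneg fun i _ => ?_) ?_)) _
    · have := h.lam_pos i; positivity
    · have h1 := hlt s
      have h2 : (0 : ℝ) ≤ s 0 := (s 0).2
      have h3 : 0 ≤ ∑ i ∈ Finset.range n,
          damp lam a b i * (s (i + 1) / (1 + lam i * s (i + 1)) : ℝ) :=
        Finset.sum_nonneg fun i _ => mul_nonneg (h.damp_nonneg i) (hd0 i)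
      linarith
  rw [hμ s n _ hn (fun _ => rfl), h.det_factor s hn (fun _ => rfl)]
  congr 1
  have h3 : 0 ≤ ∑ i ∈ Finset.range n,
      damp lam a b i * (s (i + 1) / (1 + lam i * s (i + 1)) : ℝ) :=
    Finset.sum_nonneg fun i _ => mul_nonneg (h.damp_nonneg i) (hd0 i)
  have h4 : 0 < ∏ i ∈ Finset.range n, (1 + lam i * (s (i + 1) : ℝ)) :=
    Finset.prod_pos fun i _ => by have := h.lam_pos i; positivity
  have h5 : 0 < 1 - (sumTwo lam a b)⁻¹ * uSum lam (fun i => a i * b i / lam i) s := by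
    linarith [h.ratio_lt_one s]
  have h6 : 0 < s 0 + rate lam a b + ∑ i ∈ Finset.range n,
      damp lam a b i * (s (i + 1) / (1 + lam i * s (i + 1)) : ℝ) - quadPart lam a b s := by
    have h1 := hlt s
    have h2 : (0 : ℝ) ≤ s 0 := (s 0).2
    linarith
  have h7 : ∀ (L v H : ℝ), c * L + (c * (v - L) + c * ((H - 1) * (L + (v - L)))) = c * H * v :=
    fun L v H => by ring
  rw [h7, hVs, hc, Real.rpow_neg (by positivity), Real.rpow_neg h5.le, one_div]
  rw [← Real.inv_rpow (by positivity), ← Real.inv_rpow (by positivity),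
    ← Real.inv_rpow (by positivity), ← Real.mul_rpow (by positivity) (by positivity),
    ← Real.mul_rpow (by positivity) (by positivity)]
  congr 1
  field_simp

end DefectData

/-! ### The Gaussian comparison process. -/

/-- The exponential moment of the square of a Gaussian variable with mean `m` and variance `v`. -/
theorem lintegral_exp_neg_mul_sq_gaussianReal {v c : ℝ} (hv : 0 ≤ v) (hc : 0 < 1 + v * c) (m : ℝ) :
    ∫⁻ x, ENNReal.ofReal (Real.exp (-(c * ((m + √v * x) ^ 2 / 2)))) ∂gaussianReal 0 1 =
      ENNReal.ofReal ((√(1 + v * c))⁻¹ * Real.exp (-(c / (1 + v * c) * (m ^ 2 / 2)))) := by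
  -- Completing the square gives a constant times the Gaussian density of variance `w`.
  obtain ⟨w, hw⟩ : ∃ w : ℝ≥0, (w : ℝ) = (1 + v * c)⁻¹ := ⟨⟨_, by positivity⟩, rfl⟩
  have hw0 : w ≠ 0 := fun h => (inv_pos.2 hc).ne' (by rw [← hw, h]; rfl)
  rw [gaussianReal_of_var_ne_zero _ one_ne_zero, lintegral_withDensity_eq_lintegral_mul _
    (measurable_gaussianPDF 0 1) (by fun_prop)]
  have key : ∀ x, (gaussianPDF 0 1 * fun x => ENNReal.ofReal
      (Real.exp (-(c * ((m + √v * x) ^ 2 / 2))))) x =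
      ENNReal.ofReal ((√(1 + v * c))⁻¹ * Real.exp (-(c / (1 + v * c) * (m ^ 2 / 2)))) *
        gaussianPDF (-(c * m * √v / (1 + v * c))) w x := by
    intro x
    rw [Pi.mul_apply, gaussianPDF, gaussianPDF, ← ENNReal.ofReal_mul (gaussianPDFReal_nonneg _ _ _),
      ← ENNReal.ofReal_mul (by positivity), gaussianPDFReal, gaussianPDFReal]
    congr 1
    have h1 : √(2 * Real.pi * w) = √(2 * Real.pi) * (√(1 + v * c))⁻¹ := by
      rw [Real.sqrt_mul (by positivity), hw, Real.sqrt_inv]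
    have h2 : √(1 + v * c) ≠ 0 := (Real.sqrt_pos.2 hc).ne'
    have h3 : √(2 * Real.pi) ≠ 0 := by positivity
    have h4 : ∀ A B C : ℝ, A = B + C → (√(2 * Real.pi))⁻¹ * Real.exp A =
        (√(1 + v * c))⁻¹ * Real.exp B *
          ((√(2 * Real.pi) * (√(1 + v * c))⁻¹)⁻¹ * Real.exp C) := by
      intro A B C h
      rw [h, Real.exp_add]; field_simp
    rw [h1, NNReal.coe_one, mul_one, mul_assoc, ← Real.exp_add]
    refine h4 _ _ _ ?_
    have h5 : √v ^ 2 = v := Real.sq_sqrt hv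
    rw [hw, sub_neg_eq_add, sub_zero]
    generalize √v = r at *
    subst h5
    have h6 := hc.ne'
    generalize hq : 1 + r ^ 2 * c = q at h6 ⊢
    field_simp
    subst hq
    ring
  simp only [key]
  rw [lintegral_const_mul _ (measurable_gaussianPDF _ _), lintegral_gaussianPDF_eq_one _ hw0,
    mul_one]

/-- The standard Gaussian measure in dimension `k`. -/
noncomputable abbrev stdGauss (k : ℕ) : Measure (Fin k → ℝ) :=
  Measure.pi fun _ => gaussianReal 0 1

/-- Half of the squared Euclidean norm. -/
noncomputable def halfSq {k : ℕ} (x : Fin k → ℝ) : ℝ := (∑ l, x l ^ 2) / 2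

theorem halfSq_nonneg {k : ℕ} (x : Fin k → ℝ) : 0 ≤ halfSq x := by
  unfold halfSq; positivity

theorem halfSq_smul {k : ℕ} (c : ℝ) (x : Fin k → ℝ) : halfSq (c • x) = c ^ 2 * halfSq x := by
  simp only [halfSq, Pi.smul_apply, smul_eq_mul, mul_pow, ← Finset.mul_sum]; ring

@[fun_prop]
theorem continuous_halfSq {k : ℕ} : Continuous (halfSq : (Fin k → ℝ) → ℝ) := by
  unfold halfSq; fun_prop

@[fun_prop]
theorem measurable_halfSq {k : ℕ} : Measurable (halfSq : (Fin k → ℝ) → ℝ) :=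
  continuous_halfSq.measurable

/-- Negative `c` is allowed; both the tilt and the Chernoff bound rely on this. -/
theorem lintegral_exp_neg_mul_halfSq {k : ℕ} {v c : ℝ} (hv : 0 ≤ v) (hc : 0 < 1 + v * c)
    (m : Fin k → ℝ) :
    ∫⁻ x, ENNReal.ofReal (Real.exp (-(c * halfSq (m + √v • x)))) ∂stdGauss k =
      ENNReal.ofReal ((√(1 + v * c))⁻¹ ^ k * Real.exp (-(c / (1 + v * c) * halfSq m))) := by
  have hind : iIndepFun (fun (l : Fin k) (x : Fin k → ℝ) =>
      ENNReal.ofReal (Real.exp (-(c * ((m l + √v * x l) ^ 2 / 2))))) (stdGauss k) :=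
    iIndepFun_pi (X := fun l (t : ℝ) =>
      ENNReal.ofReal (Real.exp (-(c * ((m l + √v * t) ^ 2 / 2))))) fun l => by fun_prop
  have h1 : ∀ x : Fin k → ℝ, ENNReal.ofReal (Real.exp (-(c * halfSq (m + √v • x)))) =
      ∏ l, ENNReal.ofReal (Real.exp (-(c * ((m l + √v * x l) ^ 2 / 2)))) := by
    intro x
    rw [← ENNReal.ofReal_prod_of_nonneg (fun _ _ => (Real.exp_pos _).le), ← Real.exp_sum]
    simp only [halfSq, Finset.sum_neg_distrib, ← Finset.mul_sum, Finset.sum_div, Pi.add_apply,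
      Pi.smul_apply, smul_eq_mul]
  have h2 : ∀ l : Fin k, ∫⁻ x : Fin k → ℝ,
      ENNReal.ofReal (Real.exp (-(c * ((m l + √v * x l) ^ 2 / 2)))) ∂stdGauss k =
      ENNReal.ofReal ((√(1 + v * c))⁻¹ * Real.exp (-(c / (1 + v * c) * (m l ^ 2 / 2)))) := by
    intro l
    rw [← lintegral_exp_neg_mul_sq_gaussianReal hv hc]
    exact (measurePreserving_eval (fun _ : Fin k => gaussianReal 0 1) l).lintegral_comp
      (f := fun t => ENNReal.ofReal (Real.exp (-(c * ((m l + √v * t) ^ 2 / 2))))) (by fun_prop)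
  simp only [h1]
  rw [lintegral_prod_eq_prod_lintegral_of_indepFun _ _ hind fun l => by fun_prop]
  simp only [h2]
  rw [← ENNReal.ofReal_prod_of_nonneg (fun _ _ => by positivity), Finset.prod_mul_distrib,
    ← Real.exp_sum]
  simp [halfSq, ← Finset.mul_sum, Finset.sum_div]

/-- The probability space of the comparison process: a Gaussian vector and an independent sequence
of independent Gaussian vectors. -/
noncomputable abbrev gaussSpace (k : ℕ) : Measure ((Fin k → ℝ) × (ℕ → Fin k → ℝ)) :=
  (stdGauss k).prod (Measure.infinitePi fun _ => stdGauss k)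

/-- The comparison process. -/
noncomputable def gaussProcess {k : ℕ} (lam ρ : ℕ → ℝ) (κ : ℝ)
    (ω : (Fin k → ℝ) × (ℕ → Fin k → ℝ)) : ℕ → ℝ≥0
  | 0 => (halfSq ((√κ)⁻¹ • ω.1)).toNNReal
  | i + 1 => (halfSq ((√(ρ i) * (√κ)⁻¹) • ω.1 + √(lam i) • ω.2 i)).toNNReal

theorem measurable_gaussProcess {k : ℕ} (lam ρ : ℕ → ℝ) (κ : ℝ) :
    Measurable (gaussProcess (k := k) lam ρ κ) := by
  refine measurable_pi_iff.2 fun i => ?_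
  rcases i with _ | i
  · simp only [gaussProcess]
    fun_prop
  · simp only [gaussProcess]
    fun_prop

/-- The tilted Laplace transform of the comparison process. -/
theorem lintegral_gaussProcess {k : ℕ} {lam ρ : ℕ → ℝ} {κ : ℝ} (hlam : ∀ i, 0 < lam i)
    (hρ : ∀ i, 0 ≤ ρ i) (hκ : 0 < κ) (s : ℕ →₀ ℝ≥0) (n : ℕ) (d : ℕ → ℝ) (R : ℝ)
    (hn : ∀ i, n ≤ i → s (i + 1) = 0) (hd : ∀ i, d i = s (i + 1) / (1 + lam i * s (i + 1)))
    (hR : R < κ) :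
    ∫⁻ y, ENNReal.ofReal (Real.exp (-pairing s y + R * y 0))
        ∂((gaussSpace k).map (gaussProcess lam ρ κ)) = ENNReal.ofReal
      ((κ / ((∏ i ∈ Finset.range n, (1 + lam i * s (i + 1))) *
        (s 0 + κ + ∑ i ∈ Finset.range n, ρ i * d i - R))) ^ ((k : ℝ) / 2)) := by
  rw [lintegral_map (by fun_prop) (measurable_gaussProcess _ _ _), lintegral_prod _ (by
    have := measurable_gaussProcess (k := k) lam ρ κ
    fun_prop)]
  have hp : ∀ i, 0 < 1 + lam i * (s (i + 1) : ℝ) := fun i => by have := hlam i; positivity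
  have hd0 : ∀ i, 0 ≤ d i := fun i => by rw [hd]; have := hp i; positivity
  have hS : 0 ≤ ∑ i ∈ Finset.range n, ρ i * d i :=
    Finset.sum_nonneg fun i _ => mul_nonneg (hρ i) (hd0 i)
  have hs0 : (0 : ℝ) ≤ s 0 := (s 0).2
  -- For a fixed common vector `z` the other coordinates are independent, and each contributes a
  -- constant and a factor exponential in `halfSq z`.
  have inner : ∀ z : Fin k → ℝ, ∫⁻ x : ℕ → Fin k → ℝ, ENNReal.ofReal (Real.exp
      (-pairing s (gaussProcess lam ρ κ (z, x)) + R * gaussProcess lam ρ κ (z, x) 0))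
      ∂(Measure.infinitePi fun _ => stdGauss k) =
      ENNReal.ofReal (∏ i ∈ Finset.range n, (√(1 + lam i * s (i + 1)))⁻¹ ^ k) *
      ENNReal.ofReal (Real.exp (-((s 0 - R + ∑ i ∈ Finset.range n, ρ i * d i) *
        halfSq (0 + √(κ⁻¹) • z)))) := by
    intro z
    let φ : ℕ → (Fin k → ℝ) → ℝ≥0∞ := fun i t => ENNReal.ofReal (Real.exp
      (-(s (i + 1) * halfSq ((√(ρ i) * (√κ)⁻¹) • z + √(lam i) • t))))
    have hφ : ∀ i, Measurable (φ i) := fun i => by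
      refine ENNReal.measurable_ofReal.comp (Real.measurable_exp.comp ?_)
      fun_prop
    have hind : iIndepFun (fun i (x : ℕ → Fin k → ℝ) => φ i (x i))
        (Measure.infinitePi fun _ : ℕ => stdGauss k) := iIndepFun_infinitePi (X := φ) hφ
    have h1 : ∀ x : ℕ → Fin k → ℝ, ENNReal.ofReal (Real.exp
        (-pairing s (gaussProcess lam ρ κ (z, x)) + R * gaussProcess lam ρ κ (z, x) 0)) =
        ENNReal.ofReal (Real.exp (-((s 0 - R) * halfSq (0 + √(κ⁻¹) • z)))) *
          ∏ i ∈ Finset.range n, φ i (x i) := by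
      intro x
      rw [← ENNReal.ofReal_prod_of_nonneg (fun _ _ => (Real.exp_pos _).le), ← Real.exp_sum,
        ← ENNReal.ofReal_mul (Real.exp_pos _).le, ← Real.exp_add]
      congr 2
      rw [pairing_eq_sum s _ (n := n + 1) fun i hi => by
        obtain ⟨j, rfl⟩ := Nat.exists_eq_succ_of_ne_zero (n := i) (by omega)
        exact hn j (by omega), Finset.sum_range_succ']
      simp only [gaussProcess, Real.coe_toNNReal _ (halfSq_nonneg _), Finset.sum_neg_distrib,
        zero_add, Real.sqrt_inv]
      ring
    have h2 : ∀ i, ∫⁻ x : ℕ → Fin k → ℝ, φ i (x i) ∂(Measure.infinitePi fun _ => stdGauss k) =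
        ENNReal.ofReal ((√(1 + lam i * s (i + 1)))⁻¹ ^ k *
          Real.exp (-(ρ i * d i * halfSq (0 + √(κ⁻¹) • z)))) := by
      intro i
      have := (measurePreserving_eval_infinitePi (fun _ : ℕ => stdGauss k) i).lintegral_comp (hφ i)
      refine this.trans ?_
      rw [lintegral_exp_neg_mul_halfSq (hlam i).le (hp i)]
      congr 4
      rw [zero_add, halfSq_smul, halfSq_smul, mul_pow, Real.sq_sqrt (hρ i), Real.sqrt_inv, hd]
      ring
    have hφm : ∀ i, Measurable fun x : ℕ → Fin k → ℝ => φ i (x i) :=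
      fun i => (hφ i).comp (measurable_pi_apply i)
    simp only [h1]
    rw [lintegral_const_mul _ (Finset.measurable_fun_prod _ fun i _ => hφm i)]
    have h3 := lintegral_prod_eq_prod_lintegral_of_indepFun (Finset.range n) _ hind hφm
    rw [h3]
    simp only [h2]
    rw [← ENNReal.ofReal_prod_of_nonneg (fun _ _ => by positivity), Finset.prod_mul_distrib,
      ← Real.exp_sum, mul_comm, ENNReal.ofReal_mul (Finset.prod_nonneg fun _ _ => by positivity),
      mul_assoc, ← ENNReal.ofReal_mul (Real.exp_pos _).le, ← Real.exp_add, Finset.sum_neg_distrib,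
      ← Finset.sum_mul]
    congr 3
    ring
  simp only [inner]
  -- Integrability over `z`; this is where `R < κ` is needed.
  have hpos : 0 < 1 + κ⁻¹ * (s 0 - R + ∑ i ∈ Finset.range n, ρ i * d i) := by
    have : 0 < κ⁻¹ * (κ + (s 0 - R + ∑ i ∈ Finset.range n, ρ i * d i)) :=
      mul_pos (inv_pos.2 hκ) (by linarith)
    rwa [mul_add, inv_mul_cancel₀ hκ.ne'] at this
  rw [lintegral_const_mul _ (by fun_prop), lintegral_exp_neg_mul_halfSq (inv_pos.2 hκ).le hpos,
    ← ENNReal.ofReal_mul (Finset.prod_nonneg fun _ _ => by positivity)]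
  congr 1
  have h0 : halfSq (0 : Fin k → ℝ) = 0 := by simp [halfSq]
  have hprod : 0 < ∏ i ∈ Finset.range n, (1 + lam i * (s (i + 1) : ℝ)) :=
    Finset.prod_pos fun i _ => hp i
  rw [h0, mul_zero, neg_zero, Real.exp_zero, mul_one, Finset.prod_pow, ← mul_pow,
    Finset.prod_inv_distrib, ← Real.sqrt_prod _ fun i _ => (hp i).le, ← mul_inv,
    ← Real.sqrt_mul hprod.le, ← Real.sqrt_inv, div_eq_mul_inv (k : ℝ) 2,
    mul_comm (k : ℝ), Real.rpow_mul_natCast (by exact div_nonneg hκ.le (mul_nonneg hprod.le (by linarith))), ← one_div (2 : ℝ),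
    ← Real.sqrt_eq_rpow]
  congr 2
  have : s 0 + κ + ∑ i ∈ Finset.range n, ρ i * d i - R =
    κ * (1 + κ⁻¹ * (s 0 - R + ∑ i ∈ Finset.range n, ρ i * d i)) := by field_simp; ring
  rw [this]
  field_simp

/-! ### Borel–Cantelli and the cluster set of the Gaussian vectors. -/

section BorelCantelli

variable {E : Type*} [MeasurableSpace E] {γ : Measure E} [IsProbabilityMeasure γ]

/-- First Borel–Cantelli lemma for a sequence of independent variables with law `γ`. -/
theorem ae_eventually_notMem_infinitePi {A : ℕ → Set E} (hA : ∀ i, MeasurableSet (A i)) {c : ℕ → ℝ}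
    (hc : Summable c) (h : ∀ᶠ i in atTop, γ.real (A i) ≤ c i) :
    ∀ᵐ ξ ∂(Measure.infinitePi fun _ : ℕ => γ), ∀ᶠ i in atTop, ξ i ∉ A i := by
  have hs : Summable fun i => γ.real (A i) :=
    Summable.of_norm_bounded_eventually_nat hc (by
      filter_upwards [h] with i hi
      rwa [Real.norm_of_nonneg measureReal_nonneg])
  refine ae_eventually_notMem (s := fun i => {ξ : ℕ → E | ξ i ∈ A i}) ?_
  have : ∀ i, (Measure.infinitePi fun _ : ℕ => γ) {ξ : ℕ → E | ξ i ∈ A i} =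
      ENNReal.ofReal (γ.real (A i)) := fun i => by
    rw [ofReal_measureReal]
    exact (measurePreserving_eval_infinitePi (fun _ : ℕ => γ) i).measure_preimage
      (hA i).nullMeasurableSet
  simp only [this]
  exact hs.tsum_ofReal_ne_top

/-- Second Borel–Cantelli lemma for a sequence of independent variables with law `γ`. -/
theorem ae_frequently_mem_infinitePi {A : ℕ → Set E} (hA : ∀ i, MeasurableSet (A i)) {c : ℕ → ℝ}
    (hc0 : ∀ i, 0 ≤ c i) (hc : ¬ Summable c) (h : ∀ᶠ i in atTop, c i ≤ γ.real (A i)) :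
    ∀ᵐ ξ ∂(Measure.infinitePi fun _ : ℕ => γ), ∃ᶠ i in atTop, ξ i ∈ A i := by
  have hm : ∀ i, MeasurableSet {ξ : ℕ → E | ξ i ∈ A i} := fun i => measurable_pi_apply i (hA i)
  have hmeas : ∀ i, (Measure.infinitePi fun _ : ℕ => γ) {ξ : ℕ → E | ξ i ∈ A i} = γ (A i) :=
    fun i => (measurePreserving_eval_infinitePi (fun _ : ℕ => γ) i).measure_preimage
      (hA i).nullMeasurableSet
  have hind : iIndepSet (fun i => {ξ : ℕ → E | ξ i ∈ A i}) (Measure.infinitePi fun _ : ℕ => γ) := by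
    rw [iIndepSet_iff_meas_biInter hm]
    intro s
    exact (iIndepFun_infinitePi (P := fun _ : ℕ => γ) (X := fun _ x => x)
      fun _ => measurable_id).meas_biInter fun i _ => ⟨A i, hA i, rfl⟩
  have h1 := measure_limsup_eq_one hm hind (by
    simp only [hmeas]
    by_contra hne
    refine hc (Summable.of_norm_bounded_eventually_nat (ENNReal.summable_toReal hne) ?_)
    filter_upwards [h] with i hi
    rwa [Real.norm_of_nonneg (hc0 i)])
  have h2 : ∀ᵐ ξ ∂(Measure.infinitePi fun _ : ℕ => γ),
      ξ ∈ limsup (fun i => {ξ : ℕ → E | ξ i ∈ A i}) atTop :=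
    (mem_ae_iff_prob_eq_one (MeasurableSet.measurableSet_limsup hm)).2 h1
  filter_upwards [h2] with ξ hξ
  rwa [mem_limsup_iff_frequently_mem] at hξ

end BorelCantelli

/-- A Chernoff bound. -/
theorem stdGauss_halfSq_ge_le {k : ℕ} {σ : ℝ} (h0 : 0 ≤ σ) (h1 : σ < 1) (t : ℝ) :
    (stdGauss k).real {x | t ≤ halfSq x} ≤ (√(1 - σ))⁻¹ ^ k * Real.exp (-(σ * t)) := by
  have h2 := lintegral_exp_neg_mul_halfSq (k := k) (v := 1) (c := -σ) zero_le_one (by linarith) 0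
  have h3 : halfSq (0 : Fin k → ℝ) = 0 := by simp [halfSq]
  simp only [h3, Real.sqrt_one, one_smul, zero_add, neg_mul, neg_neg, mul_zero, neg_zero,
    Real.exp_zero, mul_one, one_mul, ← sub_eq_add_neg] at h2
  have h4 := meas_ge_le_lintegral_div (μ := stdGauss k)
    (f := fun x => ENNReal.ofReal (Real.exp (σ * halfSq x))) (by fun_prop)
    (ε := ENNReal.ofReal (Real.exp (σ * t))) (by simp [Real.exp_pos]) ENNReal.ofReal_ne_top
  rw [h2, ← ENNReal.ofReal_div_of_pos (Real.exp_pos _)] at h4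
  rw [Real.exp_neg, ← div_eq_mul_inv]
  refine ENNReal.toReal_le_of_le_ofReal (by positivity) (le_trans (measure_mono fun x hx => ?_) h4)
  exact ENNReal.ofReal_le_ofReal (Real.exp_le_exp.2 (mul_le_mul_of_nonneg_left hx h0))

/-- A lower bound for the probability that a standard Gaussian variable is in an interval. -/
theorem le_gaussianReal_Ioo {a b r : ℝ} (hab : √(2 * Real.pi) ≤ b - a) (ha : -r ≤ a) (hb : b ≤ r) :
    Real.exp (-(r ^ 2 / 2)) ≤ (gaussianReal 0 1).real (Set.Ioo a b) := by
  have hpi : 0 < √(2 * Real.pi) := by positivity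
  rw [measureReal_def, ← ENNReal.ofReal_le_iff_le_toReal (measure_ne_top _ _),
    gaussianReal_apply _ one_ne_zero]
  -- The density on the interval is at least its value at `r`, and the length of the interval
  -- absorbs `1 / √(2π)`.
  calc ENNReal.ofReal (Real.exp (-(r ^ 2 / 2)))
      ≤ ∫⁻ _ in Set.Ioo a b, ENNReal.ofReal ((√(2 * Real.pi))⁻¹ * Real.exp (-(r ^ 2 / 2))) := by
        rw [setLIntegral_const, Real.volume_Ioo, ← ENNReal.ofReal_mul (by positivity)]
        refine ENNReal.ofReal_le_ofReal ?_
        rw [mul_right_comm, inv_mul_eq_div]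
        exact le_mul_of_one_le_left (Real.exp_pos _).le ((one_le_div hpi).2 hab)
    _ ≤ ∫⁻ x in Set.Ioo a b, gaussianPDF 0 1 x := by
        refine setLIntegral_mono' measurableSet_Ioo fun x hx => ?_
        refine ENNReal.ofReal_le_ofReal ?_
        have : x ^ 2 ≤ r ^ 2 := sq_le_sq' (by linarith [hx.1]) (by linarith [hx.2])
        rw [gaussianPDFReal]
        simp only [NNReal.coe_one, mul_one, sub_zero]
        gcongr
        linarith

/-- A lower bound for the probability that a small multiple of a standard Gaussian vector is close
to a given point. -/
theorem le_stdGauss_near {k : ℕ} {v ε : ℝ} (hv : 0 < v) (w : Fin k → ℝ)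
    (hε : √(2 * Real.pi) * √v ≤ 2 * ε) :
    Real.exp (-((∑ l, (|w l| + ε) ^ 2) / 2 / v)) ≤
      (stdGauss k).real {x | ∀ l, |√v * x l - w l| < ε} := by
  have hsv : 0 < √v := Real.sqrt_pos.2 hv
  have hset : {x : Fin k → ℝ | ∀ l, |√v * x l - w l| < ε} =
      Set.pi Set.univ fun l => Set.Ioo ((w l - ε) / √v) ((w l + ε) / √v) := by
    ext x
    simp only [Set.mem_ofPred_eq, Set.mem_pi, Set.mem_univ, true_imp_iff, Set.mem_Ioo, abs_lt,
      div_lt_iff₀ hsv, lt_div_iff₀ hsv]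
    refine forall_congr' fun l => ⟨fun h => ⟨by linarith [h.1], by linarith [h.2]⟩,
      fun h => ⟨by linarith [h.1], by linarith [h.2]⟩⟩
  rw [hset, measureReal_def, Measure.pi_pi, ENNReal.toReal_prod, Finset.sum_div, Finset.sum_div,
    ← Finset.sum_neg_distrib, Real.exp_sum]
  refine Finset.prod_le_prod (fun _ _ => (Real.exp_pos _).le) fun l _ => ?_
  have h1 : (|w l| + ε) ^ 2 / 2 / v = ((|w l| + ε) / √v) ^ 2 / 2 := by
    rw [div_pow, Real.sq_sqrt hv.le]; ring
  rw [h1]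
  refine le_gaussianReal_Ioo ?_ ?_ ?_
  · rw [← sub_div, le_div_iff₀ hsv]; linarith
  · rw [← neg_div]
    gcongr
    linarith [neg_abs_le (w l)]
  · gcongr
    exact le_abs_self _

section Almost

variable {k : ℕ} {lam : ℕ → ℝ} {N : ℕ} {β : ℝ}

theorem ae_eventually_halfSq_le (hlam : ∀ i, 0 < lam i) (hN : 2 ≤ N) (hβ : 0 < β)
    (hlim : Tendsto (fun i => lam i * Real.log ((N + i : ℕ) : ℝ)) atTop (𝓝 β)) {ε : ℝ}
    (hε : 0 < ε) :
    ∀ᵐ ξ ∂(Measure.infinitePi fun _ : ℕ => stdGauss k),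
      ∀ᶠ i in atTop, halfSq (√(lam i) • ξ i) ≤ β + ε := by
  -- Chernoff at level `(β + ε) / lam i` gives `exp (-(β + ε/2) / lam i)`; once `lam i * log (N + i)
  -- < β + ε/4`, this is at most `(N + i)^(-p)` with `p > 1`.
  set σ := (β + ε / 2) / (β + ε) with hσ
  set p := (β + ε / 2) / (β + ε / 4) with hp
  have hp1 : 1 < p := by rw [hp, one_lt_div (by positivity)]; linarith
  have hσ1 : σ < 1 := by rw [hσ, div_lt_one (by positivity)]; linarith
  have hsum : Summable fun i : ℕ => (√(1 - σ))⁻¹ ^ k * (((N + i : ℕ) : ℝ) ^ p)⁻¹ := by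
    refine Summable.mul_left _ ?_
    have := (summable_nat_add_iff N).2 (Real.summable_nat_rpow_inv.2 hp1)
    simpa only [add_comm N] using this
  have := ae_eventually_notMem_infinitePi (γ := stdGauss k)
    (A := fun i => {x | (β + ε) / lam i ≤ halfSq x})
    (fun i => measurableSet_le measurable_const measurable_halfSq) hsum (by
      filter_upwards [hlim.eventually (gt_mem_nhds (show β < β + ε / 4 by linarith))] with i hi
      refine (stdGauss_halfSq_ge_le (by positivity) hσ1 _).trans ?_
      have h0 : (1 : ℝ) < ((N + i : ℕ) : ℝ) := by exact_mod_cast (by omega : 1 < N + i)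
      have hl := hlam i
      gcongr
      rw [Real.rpow_def_of_pos (by linarith), ← Real.exp_neg]
      refine Real.exp_le_exp.2 (neg_le_neg ?_)
      rw [hσ, hp, div_mul_div_cancel₀ (by positivity), mul_div_assoc', div_le_div_iff₀
        (by positivity) hl]
      nlinarith)
  filter_upwards [this] with ξ hξ
  filter_upwards [hξ] with i hi
  rw [not_le, lt_div_iff₀ (hlam i)] at hi
  rw [halfSq_smul, Real.sq_sqrt (hlam i).le, mul_comm]
  exact hi.le

/-- As `halfSq w < β` strictly, a small box around `w` has probability at least `exp (-log (N + i))`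
eventually, and `∑ 1 / (N + i)` diverges. -/
theorem ae_frequently_near (hlam : ∀ i, 0 < lam i) (hlam0 : Tendsto lam atTop (𝓝 0))
    (hlim : Tendsto (fun i => lam i * Real.log ((N + i : ℕ) : ℝ)) atTop (𝓝 β))
    (hN : 2 ≤ N) {w : Fin k → ℝ} (hw : halfSq w < β) {ε : ℝ} (hε : 0 < ε) :
    ∀ᵐ ξ ∂(Measure.infinitePi fun _ : ℕ => stdGauss k),
      ∃ᶠ i in atTop, ‖√(lam i) • ξ i - w‖ < ε := by
  obtain ⟨δ, hδ, hδε, hδβ⟩ : ∃ δ > 0, δ < ε ∧ (∑ l, (|w l| + δ) ^ 2) / 2 < β := by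
    have hc : Tendsto (fun δ : ℝ => (∑ l, (|w l| + δ) ^ 2) / 2) (𝓝[>] 0) (𝓝 (halfSq w)) := by
      refine ((by fun_prop : Continuous fun δ : ℝ => (∑ l, (|w l| + δ) ^ 2) / 2).tendsto' 0 _
        ?_).mono_left nhdsWithin_le_nhds
      simp [halfSq]
    obtain ⟨δ, h1, h2, h3⟩ := ((hc.eventually (gt_mem_nhds hw)).and (eventually_mem_nhdsWithin.and
      (mem_nhdsWithin_of_mem_nhds (gt_mem_nhds hε)))).exists
    exact ⟨δ, h2, h3, h1⟩
  have hdiv : ¬ Summable fun i : ℕ => ((N + i : ℕ) : ℝ)⁻¹ := by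
    have := (summable_nat_add_iff N).not.2 Real.not_summable_natCast_inv
    simpa only [add_comm N] using this
  have hsq : Tendsto (fun i => √(2 * Real.pi) * √(lam i)) atTop (𝓝 0) := by
    simpa using ((Real.continuous_sqrt.tendsto 0).comp hlam0).const_mul (√(2 * Real.pi))
  have := ae_frequently_mem_infinitePi (γ := stdGauss k)
    (A := fun i => {x | ∀ l, |√(lam i) * x l - w l| < δ}) (fun i => by
      simp only [Set.ofPred_forall]
      exact MeasurableSet.iInter fun l => measurableSet_lt (by fun_prop) measurable_const)
    (fun i => by positivity) hdiv (by
      filter_upwards [hlim.eventually (lt_mem_nhds hδβ),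
        hsq.eventually (gt_mem_nhds (show 0 < 2 * δ by linarith))] with i hi hi2
      refine le_trans ?_ (le_stdGauss_near (hlam i) w hi2.le)
      have h0 : (0 : ℝ) < ((N + i : ℕ) : ℝ) := by exact_mod_cast (by omega : 0 < N + i)
      rw [← Real.exp_log (inv_pos.2 h0), Real.log_inv]
      refine Real.exp_le_exp.2 (neg_le_neg ?_)
      rw [div_le_iff₀ (hlam i)]
      linarith)
  filter_upwards [this] with ξ hξ
  refine hξ.mono fun i hi => ?_
  rw [pi_norm_lt_iff hε]
  exact fun l => (hi l).trans hδε

/-- The cluster set of the rescaled Gaussian vectors is a closed ball. -/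
theorem ae_cluster (hlam : ∀ i, 0 < lam i) (hlam0 : Tendsto lam atTop (𝓝 0)) (hβ : 0 < β)
    (hlim : Tendsto (fun i => lam i * Real.log ((N + i : ℕ) : ℝ)) atTop (𝓝 β)) (hN : 2 ≤ N) :
    ∀ᵐ ξ ∂(Measure.infinitePi fun _ : ℕ => stdGauss k),
      (∀ ε > 0, ∀ᶠ i in atTop, halfSq (√(lam i) • ξ i) ≤ β + ε) ∧
      ∀ w, halfSq w ≤ β → ∀ ε > 0, ∃ᶠ i in atTop, ‖√(lam i) • ξ i - w‖ < ε := by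
  obtain ⟨D, hDc, hD⟩ := TopologicalSpace.exists_countable_dense (Fin k → ℝ)
  have h1 := ae_all_iff.2 fun n : ℕ => ae_eventually_halfSq_le (k := k) hlam hN hβ hlim
    (Nat.one_div_pos_of_nat (n := n) (α := ℝ))
  -- The condition `halfSq w < β` is itself treated as a countable index type, being a proposition.
  have h2 := (ae_ball_iff hDc).2 fun w _ => ae_all_iff.2 fun n : ℕ =>
    (ae_all_iff (p := fun _ (_ : halfSq w < β) => _)).2 fun hw =>
      ae_frequently_near hlam hlam0 hlim hN hw (Nat.one_div_pos_of_nat (n := n) (α := ℝ))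
  filter_upwards [h1, h2] with ξ hξ1 hξ2
  refine ⟨fun ε hε => ?_, fun w hw ε hε => ?_⟩
  · obtain ⟨n, hn⟩ := exists_nat_one_div_lt hε
    filter_upwards [hξ1 n] with i hi
    linarith
  -- Boundary points are reached by shrinking `w` into the open ball and then approximating from the
  -- dense set.
  · have hopen : IsOpen ({x : Fin k → ℝ | halfSq x < β} ∩ Metric.ball w (ε / 2)) :=
      (isOpen_lt continuous_halfSq continuous_const).inter Metric.isOpen_ball
    have hne : ({x : Fin k → ℝ | halfSq x < β} ∩ Metric.ball w (ε / 2)).Nonempty := by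
      have hc : Tendsto (fun c : ℝ => c • w) (𝓝[<] 1) (𝓝 w) :=
        ((by fun_prop : Continuous fun c : ℝ => c • w).tendsto' 1 _ (one_smul _ _)).mono_left
          nhdsWithin_le_nhds
      obtain ⟨c, hc1, hc2, hc3⟩ := ((hc.eventually (Metric.ball_mem_nhds w (half_pos hε))).and
        (eventually_mem_nhdsWithin.and
          (mem_nhdsWithin_of_mem_nhds (lt_mem_nhds (zero_lt_one' ℝ))))).exists
      refine ⟨c • w, ?_, hc1⟩
      rw [Set.mem_ofPred_eq, halfSq_smul]
      have hc4 : c < 1 := hc2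
      have hc5 : 0 < c := hc3
      have : c ^ 2 < 1 := by nlinarith
      nlinarith [halfSq_nonneg w]
    obtain ⟨q, ⟨hq1, hq2⟩, hqD⟩ := hD.inter_open_nonempty _ hopen hne
    obtain ⟨n, hn⟩ := exists_nat_one_div_lt (half_pos hε)
    refine (hξ2 q hqD n hq1).mono fun i hi => ?_
    calc ‖√(lam i) • ξ i - w‖ ≤ ‖√(lam i) • ξ i - q‖ + ‖q - w‖ := norm_sub_le_norm_sub_add_norm_sub ..
      _ < ε := by
        rw [Metric.mem_ball, dist_eq_norm] at hq2
        linarith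

end Almost

/-! ### From the cluster set to the oscillation. -/

/-- An upper limit in the extended reals from the corresponding bounds. -/
theorem limsup_coe_eq {h : ℕ → ℝ} {L : ℝ} (hle : ∀ ε > 0, ∀ᶠ n in atTop, h n ≤ L + ε)
    (hge : ∀ ε > 0, ∃ᶠ n in atTop, L - ε ≤ h n) :
    limsup (fun n => (h n : EReal)) atTop = (L : EReal) := by
  refine le_antisymm (le_of_forall_gt_imp_ge_of_dense fun a ha => ?_)
    (le_of_forall_lt_imp_le_of_dense fun a ha => ?_)
  · obtain ⟨r, hr1, hr2⟩ := EReal.lt_iff_exists_real_btwn.1 ha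
    refine (limsup_le_of_le (by isBoundedDefault) ?_).trans hr2.le
    filter_upwards [hle (r - L) (sub_pos.2 (EReal.coe_lt_coe_iff.1 hr1))] with n hn
    exact EReal.coe_le_coe_iff.2 (by linarith)
  · obtain ⟨r, hr1, hr2⟩ := EReal.lt_iff_exists_real_btwn.1 ha
    refine hr1.le.trans (le_limsup_of_frequently_le ?_ (by isBoundedDefault))
    refine (hge (L - r) (sub_pos.2 (EReal.coe_lt_coe_iff.1 hr2))).mono fun n hn => ?_
    exact EReal.coe_le_coe_iff.2 (by linarith)

/-- A lower limit in the extended reals from the corresponding bounds. -/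
theorem liminf_coe_eq {h : ℕ → ℝ} {L : ℝ} (hge : ∀ ε > 0, ∀ᶠ n in atTop, L - ε ≤ h n)
    (hle : ∀ ε > 0, ∃ᶠ n in atTop, h n ≤ L + ε) :
    liminf (fun n => (h n : EReal)) atTop = (L : EReal) := by
  refine le_antisymm (le_of_forall_gt_imp_ge_of_dense fun a ha => ?_)
    (le_of_forall_lt_imp_le_of_dense fun a ha => ?_)
  · obtain ⟨r, hr1, hr2⟩ := EReal.lt_iff_exists_real_btwn.1 ha
    refine (liminf_le_of_frequently_le ?_ (by isBoundedDefault)).trans hr2.le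
    refine (hle (r - L) (sub_pos.2 (EReal.coe_lt_coe_iff.1 hr1))).mono fun n hn => ?_
    exact EReal.coe_le_coe_iff.2 (by linarith)
  · obtain ⟨r, hr1, hr2⟩ := EReal.lt_iff_exists_real_btwn.1 ha
    refine hr1.le.trans (le_liminf_of_le (by isBoundedDefault) ?_)
    filter_upwards [hge (L - r) (sub_pos.2 (EReal.coe_lt_coe_iff.1 hr2))] with n hn
    exact EReal.coe_le_coe_iff.2 (by linarith)

/-- The oscillation of the sequence `y` about `x` in the limit. -/
def HasOscillation (β x : ℝ) (y : ℕ → ℝ) : Prop :=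
  limsup (fun n => ((|y n - x| : ℝ) : EReal)) atTop = ((β + 2 * √β * √x : ℝ) : EReal) ∧
  limsup (fun n => ((y n - x : ℝ) : EReal)) atTop = ((β + 2 * √β * √x : ℝ) : EReal) ∧
  liminf (fun n => ((y n - x : ℝ) : EReal)) atTop =
    ((if x < β then -x else β - 2 * √β * √x : ℝ) : EReal)

theorem hasOscillation_nat_add (β x : ℝ) (y : ℕ → ℝ) (N : ℕ) :
    HasOscillation β x (fun i => y (N + i)) ↔ HasOscillation β x y := by
  simp only [HasOscillation, add_comm N]
  rw [limsup_nat_add (fun n => ((|y n - x| : ℝ) : EReal)) N,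
    limsup_nat_add (fun n => ((y n - x : ℝ) : EReal)) N,
    liminf_nat_add (fun n => ((y n - x : ℝ) : EReal)) N]

theorem measurableSet_hasOscillation (β : ℝ) :
    MeasurableSet {y : ℕ → ℝ≥0 | HasOscillation β (y 0) fun i => y (i + 1)} := by
  refine .inter (measurableSet_eq_fun (.limsup fun n => ?_) ?_)
    (.inter (measurableSet_eq_fun (.limsup fun n => ?_) ?_)
      (measurableSet_eq_fun (.liminf fun n => ?_) ?_))
  · exact measurable_coe_real_ereal.comp (by fun_prop)
  · exact measurable_coe_real_ereal.comp (by fun_prop)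
  · exact measurable_coe_real_ereal.comp (by fun_prop)
  · exact measurable_coe_real_ereal.comp (by fun_prop)
  · exact measurable_coe_real_ereal.comp (by fun_prop)
  · exact measurable_coe_real_ereal.comp (Measurable.ite
      (measurableSet_lt (by fun_prop) (by fun_prop)) (by fun_prop) (by fun_prop))

/-- `Fin k → ℝ` carries the sup norm, so the triangle inequality is borrowed from the Euclidean one.
-/
theorem sqrt_halfSq {k : ℕ} (x : Fin k → ℝ) : √(halfSq x) = ‖WithLp.toLp 2 x‖ / √2 := by
  rw [EuclideanSpace.norm_eq, halfSq, Real.sqrt_div' _ zero_le_two]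
  simp

theorem sqrt_halfSq_add_le {k : ℕ} (x y : Fin k → ℝ) :
    √(halfSq (x + y)) ≤ √(halfSq x) + √(halfSq y) := by
  simp only [sqrt_halfSq, ← add_div, WithLp.toLp_add]
  gcongr
  exact norm_add_le _ _

theorem sqrt_halfSq_smul {k : ℕ} (c : ℝ) (x : Fin k → ℝ) :
    √(halfSq (c • x)) = |c| * √(halfSq x) := by
  rw [halfSq_smul, Real.sqrt_mul (sq_nonneg c), Real.sqrt_sq_eq_abs]

theorem sub_le_sqrt_halfSq_add {k : ℕ} (x y : Fin k → ℝ) :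
    √(halfSq x) - √(halfSq y) ≤ √(halfSq (x + y)) := by
  have h1 := sqrt_halfSq_add_le (x + y) (-y)
  have h2 : halfSq (-y) = halfSq y := by simp [halfSq]
  rw [add_neg_cancel_right, h2] at h1
  linarith

/-- Every vector is a multiple of a vector `e` with `halfSq e = 1`. -/
theorem exists_unit_direction {k : ℕ} (hk : 1 ≤ k) (z : Fin k → ℝ) :
    ∃ e, halfSq e = 1 ∧ z = √(halfSq z) • e := by
  by_cases hz : halfSq z = 0
  -- For `z = 0` any direction serves; its existence requires `1 ≤ k`.
  · refine ⟨Pi.single ⟨0, hk⟩ (√2), ?_, ?_⟩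
    · rw [halfSq, Finset.sum_eq_single ⟨0, hk⟩]
      · simp
      · intro l _ hl; simp [Pi.single_eq_of_ne hl]
      · simp
    · rw [hz, Real.sqrt_zero, zero_smul]
      have h : ∑ l, z l ^ 2 = 0 := by rw [halfSq] at hz; linarith
      ext l
      simpa using (Finset.sum_eq_zero_iff_of_nonneg fun l _ => sq_nonneg (z l)).1 h l
  · have hpos : 0 < halfSq z := (halfSq_nonneg z).lt_of_ne' hz
    refine ⟨(√(halfSq z))⁻¹ • z, ?_, ?_⟩
    · rw [halfSq_smul, inv_pow, Real.sq_sqrt hpos.le, inv_mul_cancel₀ hz]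
    · rw [smul_smul, mul_inv_cancel₀ (Real.sqrt_pos.2 hpos).ne', one_smul]

section Oscillation

variable {k : ℕ} {β : ℝ} {v : ℕ → Fin k → ℝ} {z : Fin k → ℝ} {m : ℕ → ℝ}

theorem frequently_halfSq_near (hm : Tendsto m atTop (𝓝 1))
    (hL : ∀ w, halfSq w ≤ β → ∀ ε > 0, ∃ᶠ i in atTop, ‖v i - w‖ < ε) {w : Fin k → ℝ}
    (hw : halfSq w ≤ β) {ε : ℝ} (hε : 0 < ε) :
    ∃ᶠ i in atTop, |halfSq (m i • z + v i) - halfSq (z + w)| < ε := by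
  have hc : Continuous fun p : ℝ × (Fin k → ℝ) => halfSq (p.1 • z + p.2) := by fun_prop
  obtain ⟨δ, hδ, h⟩ := Metric.continuousAt_iff.1 (hc.continuousAt (x := (1, w))) ε hε
  refine ((hL w hw δ hδ).and_eventually (Metric.tendsto_nhds.1 hm δ hδ)).mono fun i hi => ?_
  have := @h (m i, v i) (by
    rw [Prod.dist_eq, max_lt_iff]
    exact ⟨hi.2, by rw [dist_eq_norm]; exact hi.1⟩)
  simpa [Real.dist_eq] using this

theorem eventually_sqrt_bounds (hm : Tendsto m atTop (𝓝 1)) (hβ : 0 < β)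
    (hU : ∀ ε > 0, ∀ᶠ i in atTop, halfSq (v i) ≤ β + ε) {δ : ℝ} (hδ : 0 < δ) :
    ∀ᶠ i in atTop, √(halfSq (m i • z + v i)) ≤ √(halfSq z) + √β + δ ∧
      √(halfSq z) - √β - δ ≤ √(halfSq (m i • z + v i)) := by
  have h1 : Tendsto (fun i => |m i| * √(halfSq z)) atTop (𝓝 (√(halfSq z))) := by
    simpa using hm.abs.mul_const (√(halfSq z))
  filter_upwards [hU (δ * √β) (by positivity), Metric.tendsto_nhds.1 h1 (δ / 2) (by positivity)]
    with i hi1 hi2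
  have h2 : √(halfSq (v i)) ≤ √β + δ / 2 := by
    refine Real.sqrt_le_iff.2 ⟨by positivity, ?_⟩
    have := Real.sq_sqrt hβ.le
    nlinarith
  rw [Real.dist_eq, abs_lt] at hi2
  have h3 := sqrt_halfSq_add_le (m i • z) (v i)
  have h4 := sub_le_sqrt_halfSq_add (m i • z) (v i)
  rw [sqrt_halfSq_smul] at h3 h4
  constructor <;> linarith

/-- The triangle inequality bounds `√(halfSq (z + w))` over the ball, and the extremes are attained
on the line of `z = r • e`: at `w = b • e` for the maximum, and at `-b • e`, or `-r • e` if `r < b`,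
for the minimum. -/
theorem hasOscillation_halfSq (hk : 1 ≤ k) (hβ : 0 < β) (hm : Tendsto m atTop (𝓝 1))
    (hU : ∀ ε > 0, ∀ᶠ i in atTop, halfSq (v i) ≤ β + ε)
    (hL : ∀ w, halfSq w ≤ β → ∀ ε > 0, ∃ᶠ i in atTop, ‖v i - w‖ < ε) :
    HasOscillation β (halfSq z) fun i => halfSq (m i • z + v i) := by
  obtain ⟨e, he, hze⟩ := exists_unit_direction hk z
  have hsb : √β ^ 2 = β := Real.sq_sqrt hβ.le
  have hsx : √(halfSq z) ^ 2 = halfSq z := Real.sq_sqrt (halfSq_nonneg z)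
  have hb0 : 0 < √β := Real.sqrt_pos.2 hβ
  have hx0 : 0 ≤ √(halfSq z) := Real.sqrt_nonneg _
  have hzw : ∀ t : ℝ, halfSq (z + t • e) = (√(halfSq z) + t) ^ 2 := fun t => by
    nth_rw 1 [hze]
    rw [← add_smul, halfSq_smul, he, mul_one]
  have hte : ∀ t : ℝ, halfSq (t • e) = t ^ 2 := fun t => by rw [halfSq_smul, he, mul_one]
  have hsq : ∀ i, √(halfSq (m i • z + v i)) ^ 2 = halfSq (m i • z + v i) :=
    fun i => Real.sq_sqrt (halfSq_nonneg _)
  set r := √(halfSq z) with hr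
  set b := √β with hb
  have hδ : ∀ ε > 0, ∃ δ > 0, ∀ᶠ i in atTop, √(halfSq (m i • z + v i)) ≤ r + b + δ ∧
      r - b - δ ≤ √(halfSq (m i • z + v i)) ∧ δ * (2 * (r + b) + 1) ≤ ε ∧ δ ≤ 1 := by
    intro ε hε
    -- With `δ ≤ 1`, this gives `(r + b + δ) ^ 2 ≤ (r + b) ^ 2 + ε`.
    refine ⟨min 1 (ε / (2 * (r + b) + 1)), by positivity, ?_⟩
    filter_upwards [eventually_sqrt_bounds (z := z) hm hβ hU
      (show 0 < min 1 (ε / (2 * (r + b) + 1)) by positivity)] with i hi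
    refine ⟨hi.1, hi.2, ?_, min_le_left _ _⟩
    rw [← le_div_iff₀ (by positivity)]
    exact min_le_right _ _
  have hupper : ∀ ε > 0, ∀ᶠ i in atTop,
      halfSq (m i • z + v i) - halfSq z ≤ β + 2 * b * r + ε := by
    intro ε hε
    obtain ⟨δ, hδ0, h⟩ := hδ ε hε
    filter_upwards [h] with i hi
    have h0 := Real.sqrt_nonneg (halfSq (m i • z + v i))
    rw [← hsq i, ← hsx, ← hsb]
    nlinarith [hi.1, hi.2.2.1, hi.2.2.2]
  have hlower : ∀ ε > 0, ∀ᶠ i in atTop,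
      (if halfSq z < β then -halfSq z else β - 2 * b * r) - ε ≤
        halfSq (m i • z + v i) - halfSq z := by
    intro ε hε
    obtain ⟨δ, hδ0, h⟩ := hδ ε hε
    filter_upwards [h] with i hi
    have h0 := halfSq_nonneg (m i • z + v i)
    split_ifs with hx
    · linarith
    · have hbr : b ≤ r := Real.sqrt_le_sqrt (not_lt.1 hx)
      rw [← hsq i, ← hsx, ← hsb]
      generalize √(halfSq (m i • z + v i)) = s at *
      -- `s ^ 2` lies above its tangent at `r - b ≥ 0`, and `s ≥ r - b - δ`.
      nlinarith [sq_nonneg (s - (r - b)), hi.2.1, hi.2.2.1]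
  have hfreq : ∀ ε > 0, ∃ᶠ i in atTop,
      β + 2 * b * r - ε ≤ halfSq (m i • z + v i) - halfSq z := by
    intro ε hε
    refine (frequently_halfSq_near (z := z) hm hL (w := b • e) (by rw [hte, hsb]) hε).mono
      fun i hi => ?_
    rw [hzw, abs_lt] at hi
    rw [← hsx, ← hsb]
    nlinarith [hi.1]
  refine ⟨limsup_coe_eq ?_ ?_, limsup_coe_eq hupper hfreq, liminf_coe_eq hlower ?_⟩
  · intro ε hε
    filter_upwards [hupper ε hε, hlower ε hε] with i h1 h2
    refine abs_le.2 ⟨?_, h1⟩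
    have : 0 ≤ b * r := by positivity
    split_ifs at h2 <;> linarith
  · intro ε hε
    exact (hfreq ε hε).mono fun i hi => hi.trans (le_abs_self _)
  · intro ε hε
    split_ifs with hx
    · refine (frequently_halfSq_near (z := z) hm hL (w := (-r) • e)
        (by rw [hte, neg_sq, hsx]; exact hx.le) hε).mono fun i hi => ?_
      rw [hzw, abs_lt] at hi
      simp only [add_neg_cancel] at hi
      nlinarith [hi.2]
    · refine (frequently_halfSq_near (z := z) hm hL (w := (-b) • e)
        (by rw [hte, neg_sq, hsb]) hε).mono fun i hi => ?_
      rw [hzw, abs_lt] at hi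
      change halfSq (m i • z + v i) - halfSq z ≤ β - 2 * b * r + ε
      nlinarith [hi.2]

end Oscillation

/-- The comparison process oscillates almost surely. -/
theorem ae_hasOscillation_gaussProcess {k : ℕ} (hk : 1 ≤ k) {lam ρ : ℕ → ℝ} {κ β : ℝ} {N : ℕ}
    (hlam : ∀ i, 0 < lam i) (hlam0 : Tendsto lam atTop (𝓝 0)) (hβ : 0 < β)
    (hlim : Tendsto (fun i => lam i * Real.log ((N + i : ℕ) : ℝ)) atTop (𝓝 β)) (hN : 2 ≤ N)
    (hρ1 : Tendsto ρ atTop (𝓝 1)) :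
    ∀ᵐ y ∂((gaussSpace k).map (gaussProcess lam ρ κ)),
      HasOscillation β (y 0) fun i => y (i + 1) := by
  rw [ae_map_iff (measurable_gaussProcess _ _ _).aemeasurable (measurableSet_hasOscillation β)]
  -- The exceptional null set involves only the independent sequence, so it serves every value of
  -- the common vector.
  filter_upwards [Measure.quasiMeasurePreserving_snd.ae
    (ae_cluster (k := k) hlam hlam0 hβ hlim hN)] with ω hω
  have hm : Tendsto (fun i => √(ρ i)) atTop (𝓝 1) := by
    simpa [Function.comp_def] using (Real.continuous_sqrt.tendsto 1).comp hρ1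
  have := hasOscillation_halfSq (z := (√κ)⁻¹ • ω.1) hk hβ hm hω.1 hω.2
  simpa only [gaussProcess, Real.coe_toNNReal _ (halfSq_nonneg _), smul_smul] using this

/-! ### Passage to the tails and conclusion. -/

section Tail

variable {lam a b : ℕ → ℝ}

theorem DefectData.tail (h : DefectData lam a b) (N : ℕ) :
    DefectData (fun i => lam (N + i)) (fun i => a (N + i)) fun i => b (N + i) := by
  have hinj : Function.Injective fun i => N + i := fun i j hij => by simpa using hij
  exact
  { lam_pos := fun i => h.lam_pos _
    a_nonneg := fun i => h.a_nonneg _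
    a_le := fun i => h.a_le _
    b_nonneg := fun i => h.b_nonneg _
    b_le := fun i => h.b_le _
    a_summable := h.a_summable.comp_injective hinj
    b_summable := h.b_summable.comp_injective hinj
    a_sum_le := le_trans (tsum_comp_le_tsum_of_inj h.a_summable
      (fun i => div_nonneg (h.a_nonneg i) (h.lam_pos i).le) hinj) h.a_sum_le
    b_sum_le := le_trans (tsum_comp_le_tsum_of_inj h.b_summable
      (fun i => div_nonneg (h.b_nonneg i) (h.lam_pos i).le) hinj) h.b_sum_le }

theorem tendsto_sumOne_tail (lam a : ℕ → ℝ) :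
    Tendsto (fun N => sumOne (fun i => lam (N + i)) fun i => a (N + i)) atTop (𝓝 1) := by
  have := (tendsto_sum_nat_add fun i => a i / lam i).const_add 1
  simpa only [sumOne, add_comm, zero_add] using this

theorem tendsto_sumTwo_tail (lam a b : ℕ → ℝ) :
    Tendsto (fun N => sumTwo (fun i => lam (N + i)) (fun i => a (N + i)) fun i => b (N + i))
      atTop (𝓝 2) := by
  have := (tendsto_sum_nat_add fun i => a i * b i / lam i).const_add 2
  simpa only [sumTwo, add_comm, zero_add] using this

/-- The comparison constant tends to one along the tails. -/
theorem tendsto_sumTwo_mul_rate_tail (lam a b : ℕ → ℝ) (α : ℝ) :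
    Tendsto (fun N => (sumTwo (fun i => lam (N + i)) (fun i => a (N + i)) (fun i => b (N + i)) *
      rate (fun i => lam (N + i)) (fun i => a (N + i)) fun i => b (N + i)) ^ (-α))
      atTop (𝓝 1) := by
  have hP := tendsto_sumOne_tail lam a
  have hQ := tendsto_sumOne_tail lam b
  have hM := tendsto_sumTwo_tail lam a b
  -- In the limit `sumOne = 1` and `sumTwo = 2`, so `rate = 1 + 1/2 - 1/2 - 1/2` and the product is
  -- `1`.
  have hr : Tendsto (fun N => rate (fun i => lam (N + i)) (fun i => a (N + i))
      fun i => b (N + i)) atTop (𝓝 (1 / 2)) := by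
    have := (((((hP.const_mul 2).mul hQ).div (hM.pow 2) (by norm_num)).const_add 1).sub
      (hP.div hM two_ne_zero)).sub (hQ.div hM two_ne_zero)
    convert this using 2
    · simp [rate]
    · norm_num
  have := (hM.mul hr).rpow_const (p := -α) (Or.inl (by norm_num))
  simpa using this

theorem DefectData.tendsto_damp (h : DefectData lam a b) (hlam0 : Tendsto lam atTop (𝓝 0)) :
    Tendsto (damp lam a b) atTop (𝓝 1) := by
  have key : ∀ c : ℕ → ℝ, (Summable fun i => c i / lam i) → Tendsto c atTop (𝓝 0) := fun c hc => by
    have := hc.tendsto_atTop_zero.mul hlam0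
    rw [mul_zero] at this
    refine this.congr fun i => ?_
    rw [div_mul_cancel₀ _ (h.lam_pos i).ne']
  have := (((key b h.b_summable).const_mul (sumOne lam a / sumTwo lam a b)).const_sub 1).mul
    (((key a h.a_summable).const_mul (sumOne lam b / sumTwo lam a b)).const_sub 1)
  change Tendsto (fun i => damp lam a b i) atTop (𝓝 1)
  simpa [damp] using this

end Tail

theorem Admissible.defectData {lam f g : ℕ → ℝ} (h : Admissible lam f g) :
    DefectData (fun i => lam (2 + i)) (fun i => 1 - f (2 + i)) fun i => 1 - g (2 + i) where
  lam_pos i := h.lam_pos _ (by omega)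
  a_nonneg i := by linarith [(h.f_mem (2 + i) (by omega)).2]
  a_le i := by linarith [(h.f_mem (2 + i) (by omega)).1]
  b_nonneg i := by linarith [(h.g_mem (2 + i) (by omega)).2]
  b_le i := by linarith [(h.g_mem (2 + i) (by omega)).1]
  a_summable := by simpa only [add_comm 2] using h.f_summable
  b_summable := by simpa only [add_comm 2] using h.g_summable
  a_sum_le := by simpa only [add_comm 2] using h.f_sum_lt.le
  b_sum_le := by simpa only [add_comm 2] using h.g_sum_lt.le

/-- A permanental sequence oscillates about its value at `0` almost surely. -/
theorem IsPermanental.ae_hasOscillation {Ω : Type*} [MeasurableSpace Ω] {P : Measure Ω}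
    [IsProbabilityMeasure P] {lam f g : ℕ → ℝ} (h : Admissible lam f g) {β : ℝ} (hβ : 0 < β)
    (hlim : Tendsto (fun n : ℕ => lam n * Real.log (n : ℝ)) atTop (𝓝 β)) {k : ℕ} (hk : 1 ≤ k)
    {X : T → Ω → ℝ} (hX : IsPermanental P ((k : ℝ) / 2) (U lam f g) X) :
    ∀ᵐ ω ∂P, HasOscillation β (X zeroPt ω) fun n => X (invPt n) ω := by
  set E := {y : ℕ → ℝ≥0 | HasOscillation β (y 0) fun i => y (i + 1)} with hE
  have hEm : MeasurableSet E := measurableSet_hasOscillation β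
  set c : ℕ → ℝ := fun N => (sumTwo (fun i => lam (2 + (N + i))) (fun i => 1 - f (2 + (N + i)))
    (fun i => 1 - g (2 + (N + i))) * rate (fun i => lam (2 + (N + i)))
      (fun i => 1 - f (2 + (N + i))) (fun i => 1 - g (2 + (N + i)))) ^ (-((k : ℝ) / 2)) with hc
  have hc1 : Tendsto c atTop (𝓝 1) := tendsto_sumTwo_mul_rate_tail (fun i => lam (2 + i))
    (fun i => 1 - f (2 + i)) (fun i => 1 - g (2 + i)) _
  have hbound : ∀ N, ENNReal.ofReal (c N) ≤ P.map (tailProcess X (2 + N)) E := by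
    intro N
    have hT := h.defectData.tail N
    have hshift : Tendsto (fun i => 2 + (N + i)) atTop atTop := by
      simpa only [← add_assoc] using tendsto_add_atTop_nat (2 + N) |>.congr fun i => by omega
    have hlam0 : Tendsto (fun i => lam (2 + (N + i))) atTop (𝓝 0) := h.lam_tendsto.comp hshift
    have hlimN : Tendsto (fun i => lam (2 + (N + i)) * Real.log ((2 + N + i : ℕ) : ℝ)) atTop
        (𝓝 β) := by
      simpa only [Function.comp_def, add_assoc] using hlim.comp hshift
    have : IsProbabilityMeasure (P.map (tailProcess X (2 + N))) :=
      Measure.isProbabilityMeasure_map (aemeasurable_tailProcess hX _)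
    have hle := hT.smul_le (α := (k : ℝ) / 2) (by positivity)
      (μ := P.map (tailProcess X (2 + N))) (ν := (gaussSpace k).map (gaussProcess _ _ _))
      (fun s n d hn hd => by
        simpa only [add_assoc, sub_sub_cancel] using laplaceTransform_tailProcess h hX
          (N := 2 + N) (by omega) s hn (d := d) (by simpa only [add_assoc] using hd))
      (fun s n d R hn hd hR => lintegral_gaussProcess hT.lam_pos hT.damp_nonneg
        (by linarith [hT.half_le_rate]) s n d R hn hd hR)
    have hae := ae_hasOscillation_gaussProcess (κ := rate (fun i => lam (2 + (N + i)))
      (fun i => 1 - f (2 + (N + i))) (fun i => 1 - g (2 + (N + i)))) hk hT.lam_pos hlam0 hβ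
      hlimN (by omega) (hT.tendsto_damp hlam0)
    have hprob : IsProbabilityMeasure ((gaussSpace k).map (gaussProcess
        (fun i => lam (2 + (N + i))) (damp (fun i => lam (2 + (N + i)))
          (fun i => 1 - f (2 + (N + i))) (fun i => 1 - g (2 + (N + i))))
        (rate (fun i => lam (2 + (N + i))) (fun i => 1 - f (2 + (N + i)))
          (fun i => 1 - g (2 + (N + i)))))) :=
      Measure.isProbabilityMeasure_map (measurable_gaussProcess _ _ _).aemeasurable
    have h1 := (mem_ae_iff_prob_eq_one hEm).1 hae
    have h2 := hle E
    rwa [Measure.smul_apply, h1, smul_eq_mul, mul_one] at h2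
  have hnn : ∀ᵐ ω ∂P, (0 ≤ X zeroPt ω) ∧ ∀ n, 0 ≤ X (invPt n) ω :=
    (hX.nonneg _).and (ae_all_iff.2 fun n => hX.nonneg _)
  -- Dropping finitely many terms changes no limit, so all tails describe one event up to a null
  -- set.
  have hiff : ∀ᵐ ω ∂P, ∀ N, tailProcess X (2 + N) ω ∈ E ↔
      HasOscillation β (X zeroPt ω) fun n => X (invPt n) ω := by
    filter_upwards [hnn] with ω hω N
    rw [← hasOscillation_nat_add β _ (fun n => X (invPt n) ω) (2 + N)]
    simp only [hE, Set.mem_ofPred_eq, tailProcess, tailPt, Real.coe_toNNReal _ hω.1,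
      Real.coe_toNNReal _ (hω.2 _)]
  have hae0 : NullMeasurableSet {ω | HasOscillation β (X zeroPt ω) fun n => X (invPt n) ω} P := by
    have h1 : NullMeasurableSet (tailProcess X (2 + 0) ⁻¹' E) P :=
      (aemeasurable_tailProcess hX _).nullMeasurableSet_preimage hEm
    refine h1.congr ?_
    filter_upwards [hiff] with ω hω
    exact propext (hω 0)
  -- This event has probability at least `c N` for every `N`, and `c N → 1`.
  have hone : 1 ≤ P {ω | HasOscillation β (X zeroPt ω) fun n => X (invPt n) ω} := by
    refine le_of_tendsto' (by simpa using ENNReal.tendsto_ofReal hc1) fun N => (hbound N).trans ?_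
    rw [Measure.map_apply_of_aemeasurable (aemeasurable_tailProcess hX _) hEm]
    refine measure_mono_ae ?_
    filter_upwards [hiff] with ω hω hmem
    exact (hω N).1 hmem
  exact (prob_compl_eq_zero_iff₀ hae0).2 (le_antisymm prob_le_one hone)

end PermSeq

/-- The upper and lower limits are taken in the extended reals, so that the equations include the
finiteness of these limits. -/
theorem theorem1p3 {Ω : Type*} [MeasurableSpace Ω] (P : Measure Ω) [IsProbabilityMeasure P]
    (lam f g : ℕ → ℝ) (hadm : PermSeq.Admissible lam f g)
    (β : ℝ) (hβ : 0 < β)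
    (hlim : Tendsto (fun n : ℕ => lam n * Real.log (n : ℝ)) atTop (𝓝 β))
    (k : ℕ) (hk : 1 ≤ k) (X : PermSeq.T → Ω → ℝ)
    (hX : PermSeq.IsPermanental P ((k : ℝ) / 2) (PermSeq.U lam f g) X) :
    (∀ᵐ ω ∂P,
      limsup (fun n : ℕ => ((|X (PermSeq.invPt n) ω - X PermSeq.zeroPt ω| : ℝ) : EReal)) atTop =
        ((β + 2 * Real.sqrt β * Real.sqrt (X PermSeq.zeroPt ω) : ℝ) : EReal)) ∧
    (∀ᵐ ω ∂P,
      limsup (fun n : ℕ => ((X (PermSeq.invPt n) ω - X PermSeq.zeroPt ω : ℝ) : EReal)) atTop =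
        ((β + 2 * Real.sqrt β * Real.sqrt (X PermSeq.zeroPt ω) : ℝ) : EReal)) ∧
    (∀ᵐ ω ∂P,
      liminf (fun n : ℕ => ((X (PermSeq.invPt n) ω - X PermSeq.zeroPt ω : ℝ) : EReal)) atTop =
        (((if X PermSeq.zeroPt ω < β then -X PermSeq.zeroPt ω
          else β - 2 * Real.sqrt β * Real.sqrt (X PermSeq.zeroPt ω)) : ℝ) : EReal)) := by
  have h := PermSeq.IsPermanental.ae_hasOscillation hadm hβ hlim hk hX
  exact ⟨h.mono fun ω hω => hω.1, h.mono fun ω hω => hω.2.1, h.mono fun ω hω => hω.2.2⟩
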